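/- **Setting.** Let $\Sigma\in\mathbb R^{p\times p}$ be a correlation matrix and $X\sim\mathcal N(0,\Sigma)$. Let $s\in\mathbb R^p$ minimize $\sum_j|1-s_j|$ subject to $0\preccurlyeq\mathrm{diag}(s)\preccurlyeq 2\Sigma$, put $S=\mathrm{diag}(s)$, and let the SDP knockoffs $\tilde X$ be given by $[X,\tilde X]\sim\mathcal N\!\left(0,\begin{bmatrix}\Sigma&\Sigma-S\\ \Sigma-S&\Sigma\end{bmatrix}\right)$ with $\tilde X$ independent of $Y$ given $X$. The response is $Y=f(X\beta+\zeta,U)$ with $f$ measurable, $\zeta\sim\mathcal N(0,\sigma_0^2)$, $\sigma_0^2>0$, $U\sim\mathrm{Unif}(0,1)$, and $\zeta,U,[X,\tilde X]$ independent. Stack $n$ i.i.d. observations into $(\mathbf X,\tilde{\mathbf X},\mathbf y)$. A *feature statistic* is a function $W=w([\mathbf X,\tilde{\mathbf X}],\mathbf y)\in\mathbb R^p$ such that, for every $J\subseteq\{1,\dots,p\}$, swapping the columns $\mathbf X_j$ and $\tilde{\mathbf X}_j$ for all $j\in J$ changes the sign of $W_j$ for $j\in J$ and leaves the other coordinates unchanged.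 It is *permutation invariant* if $\sigma(w([\mathbf X,\tilde{\mathbf X}],\mathbf y))=w([\sigma(\mathbf X),\sigma(\tilde{\mathbf X})],\mathbf y)$ for every permutation $\sigma$ of $\{1,\dots,p\}$. Randomized statistics are allowed; for these both identities are required in distribution conditional on the data. Let $\mathcal W$ be the class of all permutation invariant feature statistics. For a level $q$ let $T$ be the least $t\in\{|W_j|\}\setminus\{0\}$ with $\frac{\#\{j:W_j\le -t\}+1}{\#\{j:W_j\ge t\}}\le q$ ($T=\infty$ if there is none; a ratio with zero denominator counts as $+\infty$), let $\hat S=\{j:W_j\ge T\}$, let $\tau=|\hat S|$, and let $$\mathrm{Power}(w,\beta)=\frac{\mathbb E\,|\hat S\cap\{j:\beta_j\ne0\}|}{|\{j:\beta_j\ne0\}|},$$ the expectation being over the data (and the randomness of $w$) for fixed $w$ and $\beta$. Let $0\le q\le 0.1$ throughout. A matrix is *equicorrelated* with correlation $\rho$ if its diagonal entries are $1$ and its other entries are $\rho$. It is *block-equicorrelated* if the features are partitioned into $\ell$ blocks such that block $k$ is equicorrelated with correlation $\rho_k$ and features in different blocks have correlation $0$. **(A)** Let $\Sigma$ be equicorrelated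 with $\rho\in[0.5,1]$, let $b>0$ and $\sigma_0^2>0$ be fixed, and let $\beta^{(n)}$ be uniform on $[-b,b]^p$. If $n,p\to\infty$ with $n=o(p^{2-\epsilon})$ for some $\epsilon>0$, then $\sup_{w\in\mathcal W}\mathrm{Power}(w,\beta^{(n)})\to0$ in probability ($\rho$ and $f$ may vary along the sequence). **(B)** There are universal constants $C_1,C_2,C_3$ and, for each $\sigma_0^2>0$, a constant $c_0>0$ depending only on $\sigma_0^2$ such that the following holds. Let $\Sigma$ be block-equicorrelated with all $\rho_k\in[0.5,1]$, let $\beta\in\mathbb R^p$, and let $w\in\mathcal W$. Let $b,m>0$, and let $G_1,\dots,G_M$ be disjoint pairs of features such that for each $G_i=\{i_1,i_2\}$ the features $i_1,i_2$ lie in the same block and $|\beta_{i_1}+\beta_{i_2}|<b/m$. Put $M'=p-2M$ and assume $M'\le p/50$. Then for all $\alpha_1,\alpha_2>0$ with $\alpha_1<0.001$ and $\alpha_1\alpha_2>c_0\sqrt n\,b/m$, $$\frac{\mathbb E[\tau]}{p}\le\frac{C_1M'+C_2}{p}+C_3\,\alpha_2 .$$ **(C)** Let $\Sigma$ be block-equicorrelated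 with $\ell$ blocks of equal size and all $\rho_k\in[0.5,1]$ ($\Sigma$ and $f$ may vary along the sequence), let $b>0$ and $\sigma_0^2>0$ be fixed, and let $\beta^{(n)}$ be uniform on $[-b,b]^p$. If $n,p\to\infty$ and, for some $\epsilon>0$, $n=o\big((p/\ell)^{2-2\epsilon}\big)$ and $\ell=o\big(p/\log^{1/\epsilon}p\big)$, then $\sup_{w\in\mathcal W}\mathrm{Power}(w,\beta^{(n)})\to0$ in probability. -/

import Mathlib

open MeasureTheory ProbabilityTheory Filter Asymptotics
open scoped Topology NNReal ENNReal

namespace Knockoff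

/-- The correlation matrix of an equicorrelated design: `1` on the diagonal, `ρ` elsewhere. -/
def equicorr (p : ℕ) (ρ : ℝ) : Matrix (Fin p) (Fin p) ℝ :=
  Matrix.of fun i j => if i = j then 1 else ρ

/-- Block-equicorrelated correlation matrix. `block j` is the label of the block that contains
feature `j`, and `ρ k` is the correlation within block `k`; features in different blocks are
uncorrelated. If the labels are nondecreasing, this is `blockdiag(Σ₁, …, Σ_ℓ)`. -/
def blockEquicorr {p ℓ : ℕ} (block : Fin p → Fin ℓ) (ρ : Fin ℓ → ℝ) :
    Matrix (Fin p) (Fin p) ℝ :=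
  Matrix.of fun i j => if i = j then 1 else if block i = block j then ρ (block i) else 0

/-- The constraint `0 ≼ diag(s) ≼ 2Σ` of the semidefinite program. -/
def SDPFeasible {p : ℕ} (Sig : Matrix (Fin p) (Fin p) ℝ) (s : Fin p → ℝ) : Prop :=
  (Matrix.diagonal s).PosSemidef ∧ ((2 : ℝ) • Sig - Matrix.diagonal s).PosSemidef

/-- `s` minimizes `∑ⱼ |1 - sⱼ|` subject to `0 ≼ diag(s) ≼ 2Σ`; the choice `S = diag(s)` gives the
SDP (that is, MAC-minimizing) knockoffs. -/
def IsSDPSolution {p : ℕ} (Sig : Matrix (Fin p) (Fin p) ℝ) (s : Fin p → ℝ) : Prop :=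
  SDPFeasible Sig s ∧ ∀ t, SDPFeasible Sig t → ∑ j, |1 - s j| ≤ ∑ j, |1 - t j|

/-- The joint covariance `G_S = [[Σ, Σ - S], [Σ - S, Σ]]` of `[X, X̃]`, with `S = diag(s)`. -/
def jointCov {p : ℕ} (Sig : Matrix (Fin p) (Fin p) ℝ) (s : Fin p → ℝ) :
    Matrix (Fin p ⊕ Fin p) (Fin p ⊕ Fin p) ℝ :=
  Matrix.fromBlocks Sig (Sig - Matrix.diagonal s) (Sig - Matrix.diagonal s) Sig

/-- The observed data `([𝐗, 𝐗̃], 𝐲)`: an `n × 2p` matrix, whose columns `inl j` and `inr j` hold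
the feature `j` and its knockoff, and a response vector. -/
abbrev Data (n p : ℕ) : Type := (Fin n → Fin p ⊕ Fin p → ℝ) × (Fin n → ℝ)

/-- Law of one row `[X, X̃] ∼ N(0, G_S)`. -/
noncomputable def rowLaw {p : ℕ} (Sig : Matrix (Fin p) (Fin p) ℝ) (s : Fin p → ℝ) :
    Measure (Fin p ⊕ Fin p → ℝ) :=
  (multivariateGaussian 0 (jointCov Sig s)).map WithLp.ofLp

/-- Law of the data `([𝐗, 𝐗̃], 𝐲)`: the `n` rows `[X, X̃]` are i.i.d. `N(0, G_S)`, the `ζᵢ` are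
i.i.d. `N(0, v)`, the `Uᵢ` are i.i.d. uniform on `(0,1)`, the three families are independent, and
`yᵢ = f(Xᵢ β + ζᵢ, Uᵢ)`. In particular `X̃` is independent of `Y` given `X`. -/
noncomputable def dataLaw (n : ℕ) {p : ℕ} (Sig : Matrix (Fin p) (Fin p) ℝ) (s : Fin p → ℝ)
    (v : ℝ≥0) (f : ℝ → ℝ → ℝ) (β : Fin p → ℝ) : Measure (Data n p) :=
  ((Measure.pi fun _ : Fin n => rowLaw Sig s).prod
    ((Measure.pi fun _ : Fin n => gaussianReal 0 v).prod
      (Measure.pi fun _ : Fin n => (volume : Measure ℝ).restrict (Set.Ioo 0 1)))).map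
    fun ω => (ω.1, fun i => f ((∑ j, ω.1 i (Sum.inl j) * β j) + ω.2.1 i) (ω.2.2 i))

/-- Exchange of the column indices of `Xⱼ` and `X̃ⱼ` for `j ∈ J`. -/
def swapIdx {p : ℕ} (J : Finset (Fin p)) : Fin p ⊕ Fin p → Fin p ⊕ Fin p
  | Sum.inl j => if j ∈ J then Sum.inr j else Sum.inl j
  | Sum.inr j => if j ∈ J then Sum.inl j else Sum.inr j

/-- `([𝐗, 𝐗̃]_{swap(J)}, 𝐲)`. -/
def swapData {n p : ℕ} (J : Finset (Fin p)) (d : Data n p) : Data n p :=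
  (fun i c => d.1 i (swapIdx J c), d.2)

/-- `-𝟏_J ⊙ W`. -/
def flipSigns {p : ℕ} (J : Finset (Fin p)) (W : Fin p → ℝ) : Fin p → ℝ :=
  fun j => if j ∈ J then - W j else W j

/-- `([σ(𝐗), σ(𝐗̃)], 𝐲)`: column `j` becomes column `σ j`. -/
def permData {n p : ℕ} (σ : Equiv.Perm (Fin p)) (d : Data n p) : Data n p :=
  (fun i c => d.1 i (Sum.map σ.symm σ.symm c), d.2)

/-- `σ(W)`: coordinate `j` becomes coordinate `σ j`. -/
def permStat {p : ℕ} (σ : Equiv.Perm (Fin p)) (W : Fin p → ℝ) : Fin p → ℝ :=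
  fun j => W (σ.symm j)

/-- A permutation invariant (possibly randomized) feature statistic. `w d` is the law of
`W = w([𝐗, 𝐗̃], 𝐲)` given the data `d`; a deterministic measurable statistic is the case
`w = Kernel.deterministic _ _`, for which both laws below are equalities of vectors.
Swapping features with their knockoffs flips the signs of exactly the corresponding `Wⱼ`, and
permuting the features together with their knockoffs permutes `W` accordingly (for randomized
statistics: in distribution conditional on the data). -/
structure IsPermInvariantStat {n p : ℕ} (w : Kernel (Data n p) (Fin p → ℝ)) : Prop where
  markov : IsMarkovKernel w
  swap : ∀ (J : Finset (Fin p)) (d : Data n p), w (swapData J d) = (w d).map (flipSigns J)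
  perm : ∀ (σ : Equiv.Perm (Fin p)) (d : Data n p), w (permData σ d) = (w d).map (permStat σ)

/-- The class `𝒲` of all permutation invariant feature statistics. -/
abbrev PermInvariantStat (n p : ℕ) : Type :=
  {w : Kernel (Data n p) (Fin p → ℝ) // IsPermInvariantStat w}

open Classical in
/-- The admissible thresholds: those `t ∈ {|Wⱼ|} \ {0}` with
`(#{j : Wⱼ ≤ -t} + 1) / #{j : Wⱼ ≥ t} ≤ q`. The inequality is multiplied out, so that it fails when
the denominator is zero. -/
noncomputable def thresholds {p : ℕ} (q : ℝ) (W : Fin p → ℝ) : Finset ℝ :=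
  (Finset.univ.image fun j => |W j|).filter fun t => t ≠ 0 ∧
    ((Finset.univ.filter fun j => W j ≤ -t).card : ℝ) + 1 ≤
      q * ((Finset.univ.filter fun j => t ≤ W j).card : ℝ)

/-- The data-dependent threshold `T` (`⊤`, that is `∞`, if no threshold is admissible). -/
noncomputable def threshold {p : ℕ} (q : ℝ) (W : Fin p → ℝ) : WithTop ℝ :=
  (thresholds q W).min

open Classical in
/-- The selected set `Ŝ = {j : Wⱼ ≥ T}`. -/
noncomputable def selected {p : ℕ} (q : ℝ) (W : Fin p → ℝ) : Finset (Fin p) :=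
  Finset.univ.filter fun j => threshold q W ≤ (W j : WithTop ℝ)

/-- The expected number of discoveries `𝔼[|Ŝ|]`, for data with law `μ` and the statistic `w`. -/
noncomputable def expectedDiscoveries {n p : ℕ} (q : ℝ) (μ : Measure (Data n p))
    (w : Kernel (Data n p) (Fin p → ℝ)) : ℝ :=
  ∫ W, ((selected q W).card : ℝ) ∂(μ.bind w)

open Classical in
/-- The average power `𝔼[|Ŝ ∩ {j : βⱼ ≠ 0}|] / |{j : βⱼ ≠ 0}|`, for data with law `μ`. -/
noncomputable def power {n p : ℕ} (q : ℝ) (μ : Measure (Data n p))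
    (w : Kernel (Data n p) (Fin p → ℝ)) (β : Fin p → ℝ) : ℝ :=
  (∫ W, (((selected q W).filter fun j => β j ≠ 0).card : ℝ) ∂(μ.bind w)) /
    ((Finset.univ.filter fun j => β j ≠ 0).card : ℝ)

/-- The uniform distribution on the hypercube `[-b, b]^p`: independent coordinates, each uniform
on `[-b, b]`. -/
noncomputable def cubeLaw (p : ℕ) (b : ℝ) : Measure (Fin p → ℝ) :=
  Measure.pi fun _ => ProbabilityTheory.cond (volume : Measure ℝ) (Set.Icc (-b) b)

end Knockoff

namespace Knockoff

/-! For `ρ ≥ 1/2` the semidefinite program gives `s = 2(1 - ρ)` on every block with at least two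
features (`IsSDPSolution.eq_of_pair`). The joint covariance is then degenerate: `X_a + X̃_a = X_b +
X̃_b` almost surely for `a, b` in one block. Replacing `(X_a, X_b)` by `(X̃_b, X̃_a)`, and the
knockoffs accordingly, preserves the law of the design and moves the linear predictor only by `(β_a
+ β_b)(X̃_a - X_b)`. The Gaussian noise `ζ` hides this move up to total variation of order `√n |β_a
+ β_b| / σ₀`. The same operation sends `(W_a, W_b)` to `(-W_b, -W_a)`, so a bounded function of `W`
that is odd under it has a mean of that order (`abs_integral_odd_le`). Pairs with nearly opposite
coefficients thus have nearly symmetric signs.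

To pass from single pairs to the selected set, `exists_card_selected_le` bounds `|Ŝ|` pointwise by
`24 ∑ᵢ Fᵢ + C + 3M'`, where `|Fᵢ| ≤ 1` and `Fᵢ` is odd under the flip of the `i`-th pair. A
selection at level `q ≤ 1/10` requires some magnitude level at which positive signs greatly
outnumber negative ones. `Fᵢ` is the relative change, under a flip, of a Gibbs partition function
over all levels, a smooth substitute for the best level score. No independence between pairs is
needed: taking expectations term by term gives (B).

For (A) and (C), coefficients are classified by block and by one of `m + 1` bins of `|β_j|`, and
opposite signs are matched inside each class. The unmatched ones number at most the total sign
imbalance, of mean at most `√((m + 1) ℓ p)`. With `m ≈ (p/ℓ)^(1-ε)` both `√n / m` and the unmatched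
fraction vanish, and Markov's inequality concludes. -/

/-- The index of rank `k` from the top has at least `k` indices at or above it; ties only raise the
exponent. -/
lemma sum_pow_card_ge_le {ι : Type*} [DecidableEq ι] (u : ι → ℝ) {r : ℝ} (h0 : 0 ≤ r) (h1 : r ≤ 1)
    (s : Finset ι) :
    ∑ j ∈ s, r ^ (s.filter fun i => u j ≤ u i).card ≤ ∑ k ∈ Finset.range s.card, r ^ (k + 1) := by
  induction s using Finset.induction_on_min_value u with
  | empty => simp
  | insert a s ha hmin ih =>
    rw [Finset.sum_insert ha, Finset.card_insert_of_notMem ha, Finset.sum_range_succ, add_comm]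
    refine add_le_add (le_trans (Finset.sum_le_sum fun j _ => ?_) ih) ?_
    · exact pow_le_pow_of_le_one h0 h1
        (Finset.card_le_card (Finset.filter_subset_filter _ (Finset.subset_insert _ _)))
    · have : ((insert a s).filter fun i => u a ≤ u i) = insert a s := by
        apply Finset.filter_true_of_mem
        intro x hx
        rcases Finset.mem_insert.1 hx with rfl | hx
        · exact le_rfl
        · exact hmin x hx
      rw [this, Finset.card_insert_of_notMem ha]

/-! ### The Gibbs potential over levels and its fluxes (deterministic). -/

section SignPotential

variable {ι : Type*} [Fintype ι]

/-- The inverse temperature `log 2 / 3`; flipping one sign multiplies a weight by `2` or `1/2`. -/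
noncomputable def invTemp : ℝ := Real.log 2 / 3

lemma invTemp_pos : 0 < invTemp := by
  have := Real.log_pos (by norm_num : (1 : ℝ) < 2)
  unfold invTemp; positivity

/-- Score of a sign: `1` for a positive number, `-2` for a negative one. -/
noncomputable def signScore (t : ℝ) : ℝ := if 0 < t then 1 else if t < 0 then -2 else 0

/-- Discounted score of all indices whose magnitude is at least that of `j`. -/
noncomputable def levelScore (u t : ι → ℝ) (j : ι) : ℝ :=
  ∑ i, if u j ≤ u i then signScore (t i) - 1 / 10 else 0

/-- Partition function of the Gibbs measure on levels (`1` stands for the empty level). -/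
noncomputable def signPotential (u t : ι → ℝ) : ℝ :=
  1 + ∑ j, Real.exp (invTemp * levelScore u t j)

/-- Relative change of the potential when the `i`-th sign is flipped. -/
noncomputable def signFlux [DecidableEq ι] (u t : ι → ℝ) (i : ι) : ℝ :=
  (signPotential u t - signPotential u (Function.update t i (-t i))) /
    (signPotential u t + signPotential u (Function.update t i (-t i)))

lemma signPotential_pos (u t : ι → ℝ) : 0 < signPotential u t := by
  unfold signPotential; positivity

lemma abs_signFlux_le [DecidableEq ι] (u t : ι → ℝ) (i : ι) : |signFlux u t i| ≤ 1 := by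
  have h1 := signPotential_pos u t
  have h2 := signPotential_pos u (Function.update t i (-t i))
  rw [signFlux, abs_div, abs_of_pos (add_pos h1 h2), div_le_one (add_pos h1 h2), abs_le]
  constructor <;> linarith

lemma signFlux_update_neg [DecidableEq ι] (u t : ι → ℝ) (i : ι) :
    signFlux u (Function.update t i (-t i)) i = -signFlux u t i := by
  simp only [signFlux, Function.update_self, neg_neg, Function.update_idem,
    Function.update_eq_self]
  rw [← neg_div, neg_sub, add_comm]

lemma levelScore_update [DecidableEq ι] (u t : ι → ℝ) (i j : ι) :
    levelScore u (Function.update t i (-t i)) j = levelScore u t j +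
      if u j ≤ u i then signScore (-t i) - signScore (t i) else 0 := by
  unfold levelScore
  rw [← Finset.add_sum_erase _ _ (Finset.mem_univ i), ← Finset.add_sum_erase
    (f := fun i => if u j ≤ u i then signScore (t i) - 1 / 10 else 0) _ (Finset.mem_univ i)]
  have : ∑ x ∈ Finset.univ.erase i,
      (if u j ≤ u x then signScore (Function.update t i (-t i) x) - 1 / 10 else 0) =
      ∑ x ∈ Finset.univ.erase i, (if u j ≤ u x then signScore (t x) - 1 / 10 else 0) := by
    refine Finset.sum_congr rfl fun x hx => ?_
    rw [Function.update_of_ne (Finset.ne_of_mem_erase hx)]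
  rw [this, Function.update_self]
  split_ifs <;> ring

/-- Only the levels `j` with `u j ≤ u i` see the `i`-th sign, and their weights all change by the
same factor. -/
lemma signPotential_update [DecidableEq ι] (u t : ι → ℝ) (i : ι) :
    signPotential u (Function.update t i (-t i)) = signPotential u t +
      (Real.exp (invTemp * (signScore (-t i) - signScore (t i))) - 1) *
        ∑ j, if u j ≤ u i then Real.exp (invTemp * levelScore u t j) else 0 := by
  unfold signPotential
  rw [Finset.mul_sum, add_assoc, ← Finset.sum_add_distrib]
  congr 1
  refine Finset.sum_congr rfl fun j _ => ?_
  rw [levelScore_update]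
  split_ifs
  · rw [mul_add, Real.exp_add]; ring
  · simp

lemma exp_invTemp_mul_three : Real.exp (invTemp * 3) = 2 := by
  rw [invTemp, div_mul_cancel₀ _ (by norm_num), Real.exp_log (by norm_num)]

/-- This fixes the scores `1, -2` and the temperature. Let `Y` be the weight of the levels
containing `i`. Flipping a positive sign halves `Y`, so the flux is `(Y/2) / (2Z - Y/2) ≥ Y/(4Z)`.
Flipping a negative one doubles it, and the flux is `-Y / (2Z + Y) ≥ -2Y/(4Z)`. -/
lemma le_signFlux [DecidableEq ι] (u t : ι → ℝ) (i : ι) :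
    signScore (t i) * (∑ j, if u j ≤ u i then Real.exp (invTemp * levelScore u t j) else 0) /
      (4 * signPotential u t) ≤ signFlux u t i := by
  have hZ := signPotential_pos u t
  have hZ' := signPotential_pos u (Function.update t i (-t i))
  rw [signFlux]
  rw [signPotential_update] at hZ' ⊢
  set Z := signPotential u t
  set Y := ∑ j, if u j ≤ u i then Real.exp (invTemp * levelScore u t j) else 0 with hY
  have hY0 : 0 ≤ Y := Finset.sum_nonneg fun j _ => by split_ifs <;> positivity
  have hhalf : Real.exp (invTemp * (-3)) = 1 / 2 := by
    rw [mul_neg, Real.exp_neg, exp_invTemp_mul_three]; norm_num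
  rcases lt_trichotomy (t i) 0 with h | h | h
  · have e : signScore (-t i) - signScore (t i) = 3 := by
      simp only [signScore]; rw [if_pos (by linarith), if_neg (by linarith), if_pos h]; norm_num
    have e2 : signScore (t i) = -2 := by
      simp only [signScore]; rw [if_neg (by linarith), if_pos h]
    rw [e, exp_invTemp_mul_three] at hZ' ⊢
    rw [e2, div_le_div_iff₀ (by positivity) (by linarith)]
    nlinarith [mul_nonneg hY0 hY0, mul_nonneg hZ.le hY0]
  · simp [h, signScore]
  · have e : signScore (-t i) - signScore (t i) = -3 := by
      simp only [signScore]; rw [if_neg (by linarith), if_pos (by linarith), if_pos h]; norm_num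
    have e2 : signScore (t i) = 1 := by
      simp only [signScore]; rw [if_pos h]
    rw [e, hhalf] at hZ' ⊢
    rw [e2, div_le_div_iff₀ (by positivity) (by linarith)]
    nlinarith [mul_nonneg hY0 hY0, mul_nonneg hZ.le hY0]

/-- By `le_signFlux`, four times the total flux dominates the Gibbs mean of the undiscounted score
`V`. That mean is within a constant of any level score `m`: the discount of `1/10` per index makes
the entropy term a convergent geometric series, whatever the number of indices. -/
lemma exists_sum_signFlux_ge : ∃ C : ℝ, ∀ {ι : Type} [Fintype ι] [DecidableEq ι] (u t : ι → ℝ)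
    (m : ℝ), (m = 0 ∨ ∃ j, m = levelScore u t j) →
    m ≤ 4 * ∑ i, signFlux u t i + C := by
  set r : ℝ := Real.exp (-(invTemp / 10)) with hr
  have hη := invTemp_pos
  have hr0 : 0 < r := Real.exp_pos _
  have hr1 : r < 1 := by rw [hr, Real.exp_lt_one_iff]; linarith
  refine ⟨1 / invTemp * (1 + 1 / (1 - r)), fun {ι} _ _ u t m hm => ?_⟩
  set w : ι → ℝ := fun j => Real.exp (invTemp * levelScore u t j) with hw
  set Z := signPotential u t with hZd
  have hZ : 0 < Z := signPotential_pos u t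
  set A : ι → ℕ := fun j => (Finset.univ.filter fun i => u j ≤ u i).card with hA
  set V : ι → ℝ := fun j => ∑ i, if u j ≤ u i then signScore (t i) else 0 with hV
  have hlev : ∀ j, levelScore u t j = V j - A j / 10 := by
    intro j
    have : (A j : ℝ) / 10 = ∑ i, if u j ≤ u i then (1 / 10 : ℝ) else 0 := by
      rw [← Finset.sum_filter, Finset.sum_const, nsmul_eq_mul]; simp [hA, div_eq_mul_inv]
    rw [this, hV, ← Finset.sum_sub_distrib, levelScore]
    refine Finset.sum_congr rfl fun i _ => ?_
    split_ifs <;> simp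
  have hlin : ∀ x : ℝ, x ≤ 1 / invTemp * Real.exp (invTemp * x) := by
    intro x
    rw [one_div_mul_eq_div, le_div_iff₀ hη]
    linarith [Real.add_one_le_exp (invTemp * x)]
  have hZm : Real.exp (invTemp * m) ≤ Z := by
    rw [hZd, signPotential]
    rcases hm with rfl | ⟨j, rfl⟩
    · simp; positivity
    · have := Finset.single_le_sum (f := w) (fun i _ => (Real.exp_pos _).le) (Finset.mem_univ j)
      linarith
  -- In `exp(η(m - V)) * exp(η(V - A/10))` the score `V` cancels and only the discount `r ^ A`
  -- remains.
  have hterm : ∀ j, (m - V j) * w j ≤ 1 / invTemp * Real.exp (invTemp * m) * r ^ A j := by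
    intro j
    have := mul_le_mul_of_nonneg_right (hlin (m - V j))
      (Real.exp_pos (invTemp * levelScore u t j)).le
    refine this.trans (le_of_eq ?_)
    rw [mul_assoc, mul_assoc, ← Real.exp_add, hr, ← Real.exp_nat_mul, ← Real.exp_add, hlev]
    congr 2; ring
  have hgeom : ∑ j, r ^ A j ≤ 1 / (1 - r) := by
    have h1 := sum_pow_card_ge_le u hr0.le hr1.le Finset.univ
    refine h1.trans ?_
    have h2 : ∑ k ∈ Finset.range (Finset.univ : Finset ι).card, r ^ (k + 1) ≤
        ∑ k ∈ Finset.range (Finset.univ : Finset ι).card, r ^ k :=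
      Finset.sum_le_sum fun k _ => pow_le_pow_of_le_one hr0.le hr1.le (Nat.le_succ k)
    refine h2.trans ?_
    rw [one_div, ← tsum_geometric_of_lt_one hr0.le hr1]
    exact (summable_geometric_of_lt_one hr0.le hr1).sum_le_tsum _ fun k _ => by positivity
  have hsum : m * Z - ∑ j, V j * w j ≤ 1 / invTemp * (1 + 1 / (1 - r)) * Z := by
    have e : m * Z - ∑ j, V j * w j = m + ∑ j, (m - V j) * w j := by
      rw [hZd, signPotential, mul_add, Finset.mul_sum]
      simp only [sub_mul, Finset.sum_sub_distrib, hw]; ring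
    rw [e]
    have h1 : ∑ j, (m - V j) * w j ≤ 1 / invTemp * Real.exp (invTemp * m) * (1 / (1 - r)) :=
      calc _ ≤ ∑ j, 1 / invTemp * Real.exp (invTemp * m) * r ^ A j :=
            Finset.sum_le_sum fun j _ => hterm j
        _ = 1 / invTemp * Real.exp (invTemp * m) * ∑ j, r ^ A j := by rw [Finset.mul_sum]
        _ ≤ _ := by gcongr
    have h3 : (0 : ℝ) < 1 - r := by linarith
    calc _ ≤ 1 / invTemp * (1 + 1 / (1 - r)) * Real.exp (invTemp * m) := by
          linarith [hlin m, h1]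
      _ ≤ _ := by gcongr
  -- Exchange the sums over levels and indices, then apply `le_signFlux` index by index.
  have hflux : ∑ j, V j * w j / (4 * Z) ≤ ∑ i, signFlux u t i := by
    calc _ = ∑ i, signScore (t i) * (∑ j, if u j ≤ u i then w j else 0) / (4 * Z) := by
          rw [← Finset.sum_div, ← Finset.sum_div]
          congr 1
          simp only [hV, Finset.sum_mul, Finset.mul_sum]
          rw [Finset.sum_comm]
          refine Finset.sum_congr rfl fun i _ => Finset.sum_congr rfl fun j _ => ?_
          split_ifs <;> simp
      _ ≤ _ := Finset.sum_le_sum fun i _ => le_signFlux u t i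
  rw [← Finset.sum_div, div_le_iff₀ (by positivity)] at hflux
  have : m * Z ≤ (4 * ∑ i, signFlux u t i + 1 / invTemp * (1 + 1 / (1 - r))) * Z := by linarith
  exact le_of_mul_le_mul_right this hZ

end SignPotential

/-! ### From fluxes of pairs to the size of the selected set. -/

section Pairs

variable {p M : ℕ}

/-- The effect on `W` of swapping two features, both of them with their knockoffs, and of
exchanging their labels. -/
def flipPair (a b : Fin p) (W : Fin p → ℝ) : Fin p → ℝ :=
  permStat (Equiv.swap a b) (flipSigns {a, b} W)

lemma flipPair_left (a b : Fin p) (W : Fin p → ℝ) : flipPair a b W a = -W b := by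
  simp [flipPair, permStat, flipSigns]

lemma flipPair_right (a b : Fin p) (W : Fin p → ℝ) : flipPair a b W b = -W a := by
  simp [flipPair, permStat, flipSigns]

lemma flipPair_of_ne {a b c : Fin p} (ha : c ≠ a) (hb : c ≠ b) (W : Fin p → ℝ) :
    flipPair a b W c = W c := by
  simp [flipPair, permStat, flipSigns, Equiv.swap_apply_of_ne_of_ne ha hb, ha, hb]

/-- The larger magnitude in each pair. -/
noncomputable def pairMag (g₁ g₂ : Fin M → Fin p) (W : Fin p → ℝ) (i : Fin M) : ℝ :=
  max |W (g₁ i)| |W (g₂ i)|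

/-- The sum over each pair, whose sign is that of the entry of larger magnitude. -/
def pairSum (g₁ g₂ : Fin M → Fin p) (W : Fin p → ℝ) (i : Fin M) : ℝ := W (g₁ i) + W (g₂ i)

/-- The flux of the sign potential through the flip of the `i`-th pair. -/
noncomputable def pairFlux (g₁ g₂ : Fin M → Fin p) (i : Fin M) (W : Fin p → ℝ) : ℝ :=
  signFlux (pairMag g₁ g₂ W) (pairSum g₁ g₂ W) i

lemma abs_pairFlux_le (g₁ g₂ : Fin M → Fin p) (i : Fin M) (W : Fin p → ℝ) :
    |pairFlux g₁ g₂ i W| ≤ 1 := abs_signFlux_le _ _ _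

/-- Flipping the `i`-th pair keeps all pair magnitudes and negates exactly the `i`-th pair sum;
disjointness protects the other pairs. -/
lemma pairFlux_flipPair {g₁ g₂ : Fin M → Fin p} (hg : Function.Injective (Sum.elim g₁ g₂))
    (i : Fin M) (W : Fin p → ℝ) :
    pairFlux g₁ g₂ i (flipPair (g₁ i) (g₂ i) W) = -pairFlux g₁ g₂ i W := by
  have h11 : ∀ {k}, k ≠ i → g₁ k ≠ g₁ i := fun hk h => hk (by simpa using @hg (.inl _) (.inl _) h)
  have h22 : ∀ {k}, k ≠ i → g₂ k ≠ g₂ i := fun hk h => hk (by simpa using @hg (.inr _) (.inr _) h)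
  have h12 : ∀ k l, g₁ k ≠ g₂ l := fun k l h => by simpa using @hg (.inl _) (.inr _) h
  rw [pairFlux, pairFlux, ← signFlux_update_neg]
  congr 1
  · funext k
    by_cases hk : k = i
    · subst hk
      simp [pairMag, flipPair_left, flipPair_right, max_comm]
    · simp [pairMag, flipPair_of_ne (h11 hk) (h12 k i),
        flipPair_of_ne (h12 i k).symm (h22 hk)]
  · funext k
    by_cases hk : k = i
    · subst hk
      simp [pairSum, flipPair_left, flipPair_right]
    · simp [pairSum, flipPair_of_ne (h11 hk) (h12 k i),
        flipPair_of_ne (h12 i k).symm (h22 hk), Function.update_of_ne hk]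

lemma measurable_signScore : Measurable signScore :=
  Measurable.ite measurableSet_Ioi measurable_const
    (Measurable.ite measurableSet_Iio measurable_const measurable_const)

lemma measurable_signPotential {α ι : Type*} [MeasurableSpace α] [Fintype ι] {u t : α → ι → ℝ}
    (hu : Measurable u) (ht : Measurable t) :
    Measurable fun a => signPotential (u a) (t a) := by
  unfold signPotential levelScore
  refine measurable_const.add (Finset.measurable_sum _ fun j _ => ?_)
  refine Real.measurable_exp.comp (Measurable.const_mul (Finset.measurable_sum _ fun i _ => ?_) _)
  refine Measurable.ite ?_ ?_ measurable_const
  · exact measurableSet_le ((measurable_pi_apply j).comp hu) ((measurable_pi_apply i).comp hu)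
  · exact (measurable_signScore.comp ((measurable_pi_apply i).comp ht)).sub measurable_const

lemma measurable_pairFlux (g₁ g₂ : Fin M → Fin p) (i : Fin M) : Measurable (pairFlux g₁ g₂ i) := by
  have hu : Measurable (pairMag g₁ g₂) := by
    refine measurable_pi_lambda _ fun k => ?_
    unfold pairMag
    fun_prop
  have ht : Measurable (pairSum g₁ g₂) := by
    refine measurable_pi_lambda _ fun k => ?_
    unfold pairSum
    fun_prop
  have ht' : Measurable fun W => Function.update (pairSum g₁ g₂ W) i (-pairSum g₁ g₂ W i) := by
    refine measurable_pi_lambda _ fun k => ?_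
    by_cases hk : k = i
    · subst hk
      simp only [Function.update_self]
      exact (measurable_pi_iff.1 ht k).neg
    · simpa [Function.update_of_ne hk] using measurable_pi_iff.1 ht k
  have h1 := measurable_signPotential hu ht
  have h2 := measurable_signPotential hu ht'
  exact (h1.sub h2).div (h1.add h2)

lemma selected_eq_empty_or (q : ℝ) (W : Fin p → ℝ) :
    selected q W = ∅ ∨ ∃ T : ℝ, 0 < T ∧ (∀ j, j ∈ selected q W ↔ T ≤ W j) ∧
      ((Finset.univ.filter fun j => W j ≤ -T).card : ℝ) + 1 ≤ q * ((selected q W).card : ℝ) := by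
  classical
  rcases (thresholds q W).eq_empty_or_nonempty with h | h
  · left
    simp [selected, threshold, h]
  · right
    obtain ⟨T, hT⟩ := Finset.min_of_nonempty h
    have hmem := Finset.mem_of_min hT
    have hsel : ∀ j, j ∈ selected q W ↔ T ≤ W j := by
      intro j
      have hT' : threshold q W = T := hT
      rw [selected, Finset.mem_filter, hT', WithTop.coe_le_coe]
      simp
    have hs : selected q W = Finset.univ.filter fun j => T ≤ W j := by
      ext j; simp [hsel]
    simp only [thresholds, Finset.mem_filter, Finset.mem_image, Finset.mem_univ, true_and] at hmem
    obtain ⟨⟨k, hk⟩, h0, hle⟩ := hmem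
    refine ⟨T, lt_of_le_of_ne (hk ▸ abs_nonneg _) (Ne.symm h0), hsel, ?_⟩
    rw [hs]
    convert hle using 2

lemma sum_pairs_add_sum_unpaired {g₁ g₂ : Fin M → Fin p}
    (hg : Function.Injective (Sum.elim g₁ g₂)) (F : Fin p → ℝ) :
    ∑ j, F j = ∑ i, (F (g₁ i) + F (g₂ i)) +
      ∑ j ∈ (Finset.univ.map ⟨Sum.elim g₁ g₂, hg⟩)ᶜ, F j := by
  rw [← Finset.sum_add_sum_compl (Finset.univ.map ⟨Sum.elim g₁ g₂, hg⟩), Finset.sum_map,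
    Fintype.sum_sum_type, Finset.sum_add_distrib]
  rfl

lemma card_unpaired {g₁ g₂ : Fin M → Fin p} (hg : Function.Injective (Sum.elim g₁ g₂)) {M' : ℕ}
    (hM : M' + 2 * M = p) : (Finset.univ.map ⟨Sum.elim g₁ g₂, hg⟩)ᶜ.card = M' := by
  rw [Finset.card_compl, Finset.card_map]
  simp
  omega

/-- The constants are forced by two tight cases: two discoveries share a score of `0.9`, and one
entry on each side with a negative sum scores `-2.1 = 0.45 - 2.55`. -/
lemma pair_score_ge {x y T : ℝ} (hT : 0 < T) :
    0.45 * ((if T ≤ x then 1 else 0) + (if T ≤ y then 1 else 0)) -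
      2.55 * ((if x ≤ -T then 1 else 0) + (if y ≤ -T then 1 else 0)) ≤
    (if T ≤ max |x| |y| then signScore (x + y) - 1 / 10 else 0) := by
  by_cases h : T ≤ max |x| |y|
  · rw [if_pos h]
    have h' : T ≤ x ∨ x ≤ -T ∨ T ≤ y ∨ y ≤ -T := by
      rcases le_max_iff.1 h with h | h <;> rcases le_abs.1 h with h | h
      · exact Or.inl h
      · exact Or.inr (Or.inl (by linarith))
      · exact Or.inr (Or.inr (Or.inl h))
      · exact Or.inr (Or.inr (Or.inr (by linarith)))
    unfold signScore
    split_ifs <;> first | (norm_num; done) | (exfalso; rcases h' with h' | h' | h' | h' <;> linarith)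
  · rw [if_neg h]
    push Not at h
    obtain ⟨hx, hy⟩ := max_lt_iff.1 h
    have := abs_lt.1 hx
    have := abs_lt.1 hy
    rw [if_neg (by linarith), if_neg (by linarith), if_neg (by linarith), if_neg (by linarith)]
    norm_num

/-- The number of discoveries is controlled, pointwise, by the fluxes of the pairs. -/
lemma exists_card_selected_le : ∃ C : ℝ, 0 ≤ C ∧ ∀ {p M M' : ℕ} (q : ℝ) (g₁ g₂ : Fin M → Fin p)
    (W : Fin p → ℝ), q ≤ 1 / 10 → Function.Injective (Sum.elim g₁ g₂) → M' + 2 * M = p →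
    ((selected q W).card : ℝ) ≤ 24 * ∑ i, pairFlux g₁ g₂ i W + C + 3 * M' := by
  classical
  obtain ⟨C, hC⟩ := exists_sum_signFlux_ge
  refine ⟨6 * |C|, by positivity, fun {p M M'} q g₁ g₂ W hq hg hM => ?_⟩
  set Φ := ∑ i, pairFlux g₁ g₂ i W with hΦ
  have hC' := le_abs_self C
  have key : ∀ m : ℝ, (m = 0 ∨ ∃ j, m = levelScore (pairMag g₁ g₂ W) (pairSum g₁ g₂ W) j) →
      m ≤ 4 * Φ + C := fun m hm => hC _ _ m hm
  -- The empty level gives this sign; it settles the case of no selection and allows constants to be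
  -- rounded up at the end.
  have hΦ0 : 0 ≤ 4 * Φ + |C| := le_trans (key 0 (Or.inl rfl)) (by linarith)
  rcases selected_eq_empty_or q W with h | ⟨T, hT, hsel, hN⟩
  · rw [h]
    have h1 : (0 : ℝ) ≤ M' := Nat.cast_nonneg _
    simp only [Finset.card_empty, Nat.cast_zero]
    linarith
  set m : ℝ := ∑ i, if T ≤ pairMag g₁ g₂ W i then
    signScore (pairSum g₁ g₂ W i) - 1 / 10 else 0 with hm
  have hmlev : m = 0 ∨ ∃ j, m = levelScore (pairMag g₁ g₂ W) (pairSum g₁ g₂ W) j := by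
    rcases (Finset.univ.filter fun i => T ≤ pairMag g₁ g₂ W i).eq_empty_or_nonempty with h | h
    · left
      rw [hm, ← Finset.sum_filter, h, Finset.sum_empty]
    · right
      -- The level cut at `T` is also the level of its smallest magnitude.
      obtain ⟨j, hj, hmin⟩ := Finset.exists_min_image _ (pairMag g₁ g₂ W) h
      refine ⟨j, Finset.sum_congr rfl fun i _ => if_congr ⟨fun hi => ?_, fun hi => ?_⟩ rfl rfl⟩
      · exact hmin i (by simpa using hi)
      · exact le_trans (by simpa using hj) hi
  have hmle := key m hmlev
  have hτ : ((selected q W).card : ℝ) = ∑ j, if T ≤ W j then (1 : ℝ) else 0 := by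
    rw [← Finset.sum_filter, Finset.sum_const, nsmul_eq_mul, mul_one]
    congr 2
    ext j; simp [hsel]
  have hNc : ((Finset.univ.filter fun j => W j ≤ -T).card : ℝ) =
      ∑ j, if W j ≤ -T then (1 : ℝ) else 0 := by
    rw [← Finset.sum_filter, Finset.sum_const, nsmul_eq_mul, mul_one]
  have e1 := sum_pairs_add_sum_unpaired hg fun j => if T ≤ W j then (1 : ℝ) else 0
  have e2 := sum_pairs_add_sum_unpaired hg fun j => if W j ≤ -T then (1 : ℝ) else 0
  have b1 : ∑ j ∈ (Finset.univ.map ⟨Sum.elim g₁ g₂, hg⟩)ᶜ, (if T ≤ W j then (1 : ℝ) else 0)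
      ≤ M' := by
    rw [← card_unpaired hg hM, Finset.card_eq_sum_ones, Nat.cast_sum]
    refine Finset.sum_le_sum fun j _ => ?_
    split_ifs <;> simp
  have b2 : 0 ≤ ∑ j ∈ (Finset.univ.map ⟨Sum.elim g₁ g₂, hg⟩)ᶜ, (if W j ≤ -T then (1 : ℝ) else 0) :=
    Finset.sum_nonneg fun j _ => by split_ifs <;> simp
  have hsum : 0.45 * ∑ i, ((if T ≤ W (g₁ i) then (1 : ℝ) else 0) +
        (if T ≤ W (g₂ i) then 1 else 0)) -
      2.55 * ∑ i, ((if W (g₁ i) ≤ -T then (1 : ℝ) else 0) + (if W (g₂ i) ≤ -T then 1 else 0)) ≤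
      m := by
    rw [Finset.mul_sum, Finset.mul_sum, ← Finset.sum_sub_distrib]
    exact Finset.sum_le_sum fun i _ => pair_score_ge hT
  have hqτ : q * ((selected q W).card : ℝ) ≤ 1 / 10 * ((selected q W).card : ℝ) := by gcongr
  rw [hNc] at hN
  rw [← hτ] at e1
  -- With `N ≤ τ/10 - 1` negatives, the score is at least `0.45 (τ - M') - 2.55 N ≥ 0.195 τ - 0.45
  -- M'`, and `1/0.195 < 6` yields the factors `24`, `6` and `3`.
  linarith

end Pairs

/-! ### The SDP solution on block-equicorrelated designs. -/

section SDP

open Matrix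

variable {p ℓ : ℕ}

lemma blockEquicorr_mulVec (block : Fin p → Fin ℓ) (ρ : Fin ℓ → ℝ) (x : Fin p → ℝ) (i : Fin p) :
    (blockEquicorr block ρ *ᵥ x) i = (1 - ρ (block i)) * x i +
      ρ (block i) * ∑ j, if block j = block i then x j else 0 := by
  have h : ∀ j, blockEquicorr block ρ i j * x j =
      (if j = i then (1 - ρ (block i)) * x j else 0) +
        ρ (block i) * (if block j = block i then x j else 0) := by
    intro j
    simp only [blockEquicorr, Matrix.of_apply]
    by_cases hij : i = j
    · subst hij; simp; ring
    · rw [if_neg hij, if_neg (Ne.symm hij)]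
      by_cases hb : block i = block j
      · rw [if_pos hb, if_pos hb.symm]; ring
      · rw [if_neg hb, if_neg (Ne.symm hb)]; ring
  rw [Matrix.mulVec, dotProduct, Finset.sum_congr rfl fun j _ => h j, Finset.sum_add_distrib,
    ← Finset.mul_sum]
  simp

lemma blockEquicorr_quadForm (block : Fin p → Fin ℓ) (ρ : Fin ℓ → ℝ) (x : Fin p → ℝ) :
    x ⬝ᵥ (blockEquicorr block ρ *ᵥ x) = ∑ i, (1 - ρ (block i)) * x i ^ 2 +
      ∑ k, ρ k * (∑ j, if block j = k then x j else 0) ^ 2 := by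
  have h : ∀ k, ρ k * (∑ j, if block j = k then x j else 0) ^ 2 =
      ∑ i, if block i = k then x i * (ρ k * ∑ j, if block j = k then x j else 0) else 0 := by
    intro k
    rw [sq, ← mul_assoc, mul_comm, Finset.sum_mul]
    refine Finset.sum_congr rfl fun i _ => ?_
    split_ifs <;> simp
  rw [Finset.sum_congr rfl fun k _ => h k, Finset.sum_comm, ← Finset.sum_add_distrib, dotProduct]
  refine Finset.sum_congr rfl fun i _ => ?_
  rw [blockEquicorr_mulVec, Finset.sum_ite_eq]
  simp; ring

lemma isHermitian_blockEquicorr (block : Fin p → Fin ℓ) (ρ : Fin ℓ → ℝ) :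
    (blockEquicorr block ρ).IsHermitian := by
  ext i j
  simp only [conjTranspose_apply, blockEquicorr, of_apply, star_trivial]
  by_cases h : i = j
  · simp [h]
  · rw [if_neg h, if_neg (Ne.symm h)]
    by_cases hb : block i = block j
    · simp [hb]
    · rw [if_neg hb, if_neg (Ne.symm hb)]

lemma sdp_quadForm (block : Fin p → Fin ℓ) (ρ : Fin ℓ → ℝ) (s x : Fin p → ℝ) :
    star x ⬝ᵥ (((2 : ℝ) • blockEquicorr block ρ - diagonal s) *ᵥ x) =
      ∑ i, (2 * (1 - ρ (block i)) - s i) * x i ^ 2 +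
        ∑ k, 2 * ρ k * (∑ j, if block j = k then x j else 0) ^ 2 := by
  rw [star_trivial, sub_mulVec, dotProduct_sub, smul_mulVec, dotProduct_smul,
    blockEquicorr_quadForm, smul_eq_mul, mul_add, Finset.mul_sum, Finset.mul_sum]
  simp only [sub_mul, Finset.sum_sub_distrib, mul_assoc]
  have : x ⬝ᵥ (diagonal s *ᵥ x) = ∑ i, s i * x i ^ 2 := by
    simp only [dotProduct, mulVec_diagonal]
    exact Finset.sum_congr rfl fun i _ => by ring
  rw [this]; ring

/-- Equalizing `s` at `2(1 - ρ)` on one block keeps it feasible. -/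
lemma SDPFeasible.equalize_block {block : Fin p → Fin ℓ} {ρ : Fin ℓ → ℝ}
    (hρ : ∀ k, 1 / 2 ≤ ρ k ∧ ρ k ≤ 1) {s : Fin p → ℝ}
    (hs : SDPFeasible (blockEquicorr block ρ) s) (b : Fin ℓ) :
    SDPFeasible (blockEquicorr block ρ) fun j => if block j = b then 2 * (1 - ρ b) else s j := by
  have hs0 : ∀ j, 0 ≤ s j := posSemidef_diagonal_iff.1 hs.1
  refine ⟨posSemidef_diagonal_iff.2 fun j => ?_, ?_⟩
  · split_ifs
    · linarith [(hρ b).2]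
    · exact hs0 j
  refine PosSemidef.of_dotProduct_mulVec_nonneg ?_ fun x => ?_
  · exact ((isHermitian_blockEquicorr block ρ).smul (k := (2 : ℝ)) (by simp)).sub
      (isHermitian_diagonal _)
  -- After equalizing, block `b` contributes only `2ρ_b` times a square, so the old form at `x` with
  -- block `b` zeroed is a lower bound.
  have h := hs.2.dotProduct_mulVec_nonneg fun j => if block j = b then 0 else x j
  rw [sdp_quadForm] at h ⊢
  refine h.trans (add_le_add (Finset.sum_le_sum fun i _ => ?_) (Finset.sum_le_sum fun k _ => ?_))
  · by_cases hi : block i = b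
    · simp [hi]
    · simp [hi]
  · by_cases hk : k = b
    · subst hk
      have : ∑ j, (if block j = k then (if block j = k then 0 else x j) else 0) = 0 :=
        Finset.sum_eq_zero fun j _ => by split_ifs <;> rfl
      rw [this]
      have := (hρ k).1
      have : 0 ≤ ρ k := by linarith
      simp; positivity
    · refine le_of_eq ?_
      congr 2
      refine Finset.sum_congr rfl fun j _ => ?_
      by_cases hj : block j = k
      · rw [if_pos hj, if_pos hj, if_neg (hj ▸ hk)]
      · rw [if_neg hj, if_neg hj]

lemma SDPFeasible.pair_quadForm_nonneg {block : Fin p → Fin ℓ} {ρ : Fin ℓ → ℝ} {s : Fin p → ℝ}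
    (hs : SDPFeasible (blockEquicorr block ρ) s) {i j : Fin p} (hij : i ≠ j)
    (hb : block i = block j) (x y : ℝ) :
    0 ≤ 2 * ρ (block i) * (x + y) ^ 2 + (2 * (1 - ρ (block i)) - s i) * x ^ 2 +
      (2 * (1 - ρ (block i)) - s j) * y ^ 2 := by
  have h := (hs.2.submatrix ![i, j]).dotProduct_mulVec_nonneg ![x, y]
  have hii : ∀ i, blockEquicorr block ρ i i = 1 := fun i => by simp [blockEquicorr]
  have hoff : blockEquicorr block ρ i j = ρ (block i) := by simp [blockEquicorr, hij, hb]
  have hoff' : blockEquicorr block ρ j i = ρ (block i) := by simp [blockEquicorr, hij.symm, hb]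
  simp only [star_trivial, dotProduct, mulVec, Fin.sum_univ_two, submatrix_apply,
    Matrix.sub_apply, Matrix.smul_apply, cons_val_zero, cons_val_one, smul_eq_mul,
    diagonal_apply_eq, diagonal_apply_ne _ hij, diagonal_apply_ne _ hij.symm, hii, hoff,
    hoff'] at h
  linarith

/-- On a block with at least two features, the SDP solution is `2(1 - ρ)`. -/
lemma IsSDPSolution.eq_of_pair {block : Fin p → Fin ℓ} {ρ : Fin ℓ → ℝ}
    (hρ : ∀ k, 1 / 2 ≤ ρ k ∧ ρ k ≤ 1) {s : Fin p → ℝ}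
    (hs : IsSDPSolution (blockEquicorr block ρ) s) {a b : Fin p} (hab : a ≠ b)
    (hblock : block a = block b) :
    s a = 2 * (1 - ρ (block a)) ∧ s b = 2 * (1 - ρ (block a)) := by
  set r := ρ (block a) with hr
  set d : Fin p → ℝ := fun j => s j - 2 * (1 - r) with hd
  set B := Finset.univ.filter fun j => block j = block a with hB
  have hmemB : ∀ {j}, j ∈ B ↔ block j = block a := by simp [hB]
  have hquad : ∀ {i j}, i ∈ B → j ∈ B → i ≠ j → ∀ x y : ℝ,
      0 ≤ 2 * r * (x + y) ^ 2 - d i * x ^ 2 - d j * y ^ 2 := by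
    intro i j hi hj hij x y
    have := hs.1.pair_quadForm_nonneg hij ((hmemB.1 hi).trans (hmemB.1 hj).symm) x y
    rw [hmemB.1 hi] at this
    simp only [hd]
    linarith
  have hpair : ∀ {i j}, i ∈ B → j ∈ B → i ≠ j → d i + d j ≤ 0 := by
    intro i j hi hj hij
    -- The direction `(1, -1)` kills the common part, so the excesses `d` of two features in the
    -- block cannot sum to a positive number.
    have := hquad hi hj hij 1 (-1)
    norm_num at this
    linarith
  have hr1 : 1 / 2 ≤ r := (hρ _).1
  have hr2 : r ≤ 1 := (hρ _).2
  -- Optimality against the equalized competitor. Since `ρ ≥ 1/2`, the value `2(1 - ρ)` is at most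
  -- `1`, so its absolute value in the objective opens.
  have hsum : 0 ≤ ∑ j ∈ B, d j := by
    have h := hs.2 _ (hs.1.equalize_block hρ (block a))
    rw [← Finset.sum_filter_add_sum_filter_not Finset.univ (fun j => block j = block a)
      (fun j => |1 - s j|), ← Finset.sum_filter_add_sum_filter_not Finset.univ
      (fun j => block j = block a) (fun j => |1 - if block j = block a then _ else s j|)] at h
    have e1 : ∑ j ∈ Finset.univ.filter (fun j => ¬ block j = block a),
        |1 - if block j = block a then 2 * (1 - ρ (block a)) else s j| =
        ∑ j ∈ Finset.univ.filter (fun j => ¬ block j = block a), |1 - s j| :=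
      Finset.sum_congr rfl fun j hj => by rw [if_neg (Finset.mem_filter.1 hj).2]
    rw [e1] at h
    have h' := le_of_add_le_add_right h
    have e2 : ∑ j ∈ B, |1 - if block j = block a then 2 * (1 - ρ (block a)) else s j| =
        ∑ j ∈ B, (1 - 2 * (1 - r)) := by
      refine Finset.sum_congr rfl fun j hj => ?_
      rw [if_pos (hmemB.1 hj), abs_of_nonneg]
      linarith
    have h'' : ∑ j ∈ B, |1 - s j| ≤ ∑ j ∈ B, (1 - 2 * (1 - r)) := h'.trans e2.le
    have h3 : ∑ j ∈ B, (1 - s j) ≤ ∑ j ∈ B, |1 - s j| :=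
      Finset.sum_le_sum fun j _ => le_abs_self _
    have h4 := sub_nonneg.2 (h3.trans h'')
    rw [← Finset.sum_sub_distrib] at h4
    refine h4.trans (le_of_eq (Finset.sum_congr rfl fun j _ => ?_))
    simp only [hd]; ring
  have ha : a ∈ B := hmemB.2 rfl
  have hb : b ∈ B := hmemB.2 hblock.symm
  have hb' : b ∈ B.erase a := Finset.mem_erase.2 ⟨hab.symm, hb⟩
  have hsplit : ∑ j ∈ B, d j = d a + (d b + ∑ j ∈ (B.erase a).erase b, d j) := by
    rw [Finset.add_sum_erase _ _ hb', Finset.add_sum_erase _ _ ha]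
  by_cases hR : ∀ j ∈ (B.erase a).erase b, d j ≤ 0
  · have hR' := Finset.sum_nonpos hR
    have h0 := hpair ha hb hab
    have hda : d b = -d a := by linarith
    -- Here `d b = -d a`. Perturbing `(1, -1)` by `±e` in the first coordinate leaves a term linear
    -- in `d a * e` against `2r e²`, which forces `d a = 0`.
    have hz : d a = 0 := by
      have hq1 := fun e : ℝ => hquad ha hb hab (1 + e) (-1)
      have hq2 := fun e : ℝ => hquad ha hb hab (1 - e) (-1)
      simp only [hda] at hq1 hq2
      have hq : ∀ e : ℝ, 0 < e → |d a| * (2 - e) ≤ 2 * r * e := by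
        intro e he
        have a1 := hq1 e
        have a2 := hq2 e
        rcases abs_cases (d a) with ⟨h, h'⟩ | ⟨h, h'⟩ <;> rw [h]
        · have : 0 ≤ e * (2 * r * e - d a * (2 + e)) := by nlinarith
          have := nonneg_of_mul_nonneg_right this he
          nlinarith
        · have : 0 ≤ e * (2 * r * e + d a * (2 - e)) := by nlinarith
          have := nonneg_of_mul_nonneg_right this he
          nlinarith
      by_contra hne
      have hpos : 0 < |d a| := abs_pos.2 hne
      have := hq (min 1 (|d a| / 4)) (by positivity)
      have m1 := min_le_left 1 (|d a| / 4)
      have m2 := min_le_right 1 (|d a| / 4)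
      nlinarith [mul_nonneg hpos.le (by linarith : 0 ≤ 1 - min 1 (|d a| / 4)),
        (lt_min one_pos (by positivity) : 0 < min 1 (|d a| / 4))]
    have hz' : d b = 0 := by rw [hda, hz, neg_zero]
    simp only [hd] at hz hz'
    exact ⟨by linarith, by linarith⟩
  -- If some other `d j > 0`, every other excess in the block is at most `-d j`; `a` and `b` alone
  -- outweigh `d j`, so the block sum is negative.
  · exfalso
    push Not at hR
    obtain ⟨j, hj, hjpos⟩ := hR
    have hjB : j ∈ B := Finset.mem_of_mem_erase (Finset.mem_of_mem_erase hj)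
    have hja : j ≠ a := Finset.ne_of_mem_erase (Finset.mem_of_mem_erase hj)
    have hjb : j ≠ b := Finset.ne_of_mem_erase hj
    have h1 := hpair hjB ha hja
    have h2 := hpair hjB hb hjb
    have h3 : ∑ i ∈ ((B.erase a).erase b).erase j, d i ≤ 0 := by
      refine Finset.sum_nonpos fun i hi => ?_
      have := hpair (Finset.mem_of_mem_erase (Finset.mem_of_mem_erase
        (Finset.mem_of_mem_erase hi))) hjB (Finset.ne_of_mem_erase hi)
      linarith
    rw [← Finset.add_sum_erase _ _ hj] at hsplit
    linarith

/-- Twice the quadratic form at `(x, y)` equals `(x+y)ᵀ(2Σ - S)(x+y) + (x-y)ᵀS(x-y)`. -/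
lemma SDPFeasible.posSemidef_jointCov {Sig : Matrix (Fin p) (Fin p) ℝ} {s : Fin p → ℝ}
    (hSig : Sig.IsHermitian) (hs : SDPFeasible Sig s) : (jointCov Sig s).PosSemidef := by
  have hherm : (Sig - diagonal s).IsHermitian := hSig.sub (isHermitian_diagonal s)
  refine PosSemidef.of_dotProduct_mulVec_nonneg (hSig.fromBlocks hherm.eq hSig) fun z => ?_
  obtain ⟨x, y, rfl⟩ : ∃ x y, z = Sum.elim x y := ⟨z ∘ Sum.inl, z ∘ Sum.inr, by simp⟩
  have h1 := hs.2.dotProduct_mulVec_nonneg (x + y)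
  have h2 := hs.1.dotProduct_mulVec_nonneg (x - y)
  have hsym : y ⬝ᵥ (diagonal s *ᵥ x) = x ⬝ᵥ (diagonal s *ᵥ y) := by
    simp only [dotProduct, mulVec_diagonal]
    exact Finset.sum_congr rfl fun i _ => by ring
  simp only [star_trivial, jointCov, fromBlocks_mulVec, sumElim_dotProduct_sumElim,
    Sum.elim_comp_inl, Sum.elim_comp_inr, sub_mulVec, smul_mulVec, mulVec_add, mulVec_sub,
    dotProduct_add, add_dotProduct, dotProduct_sub, sub_dotProduct, dotProduct_smul,
    smul_eq_mul] at h1 h2 ⊢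
  linarith

end SDP

/-! ### Linear functionals and symmetries of the Gaussian row law. -/

section RowLaw

open Matrix

variable {p : ℕ} {Sig : Matrix (Fin p) (Fin p) ℝ} {s : Fin p → ℝ}

instance : IsProbabilityMeasure (rowLaw Sig s) :=
  Measure.isProbabilityMeasure_map (by fun_prop)

lemma rowLaw_map_linear (hG : (jointCov Sig s).PosSemidef) (a : Fin p ⊕ Fin p → ℝ) :
    (rowLaw Sig s).map (fun z => ∑ c, a c * z c) =
      gaussianReal 0 (a ⬝ᵥ (jointCov Sig s *ᵥ a)).toNNReal := by
  set μ := multivariateGaussian 0 (jointCov Sig s)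
  have hL : (fun z : Fin p ⊕ Fin p → ℝ => ∑ c, a c * z c) ∘ WithLp.ofLp =
      (innerSL ℝ (WithLp.toLp 2 a) : EuclideanSpace ℝ (Fin p ⊕ Fin p) →L[ℝ] ℝ) := by
    ext z
    simp [PiLp.inner_apply, mul_comm]
  rw [rowLaw, Measure.map_map (by fun_prop) (by fun_prop), hL, IsGaussian.map_eq_gaussianReal]
  congr 1
  · have h0 := (innerSL ℝ (WithLp.toLp 2 a) :
      EuclideanSpace ℝ (Fin p ⊕ Fin p) →L[ℝ] ℝ).integral_comp_id_comm
        (IsGaussian.integrable_id (μ := μ))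
    refine h0.trans ?_
    rw [integral_id_multivariateGaussian, map_zero]
  · congr 1
    have := covarianceBilin_self (μ := μ) IsGaussian.memLp_two_id (WithLp.toLp 2 a)
    rw [covarianceBilin_multivariateGaussian hG] at this
    exact this.symm

/-- The law is determined by its linear functionals, which are centred Gaussians with variances read
off the covariance; degenerate covariances are included. -/
lemma measurePreserving_rowLaw_comp (hG : (jointCov Sig s).PosSemidef)
    (π : Equiv.Perm (Fin p ⊕ Fin p))
    (hπ : ∀ c d, jointCov Sig s (π c) (π d) = jointCov Sig s c d) :
    MeasurePreserving (fun (z : Fin p ⊕ Fin p → ℝ) c => z (π c)) (rowLaw Sig s) (rowLaw Sig s) := by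
  have hm : Measurable fun (z : Fin p ⊕ Fin p → ℝ) c => z (π c) := by fun_prop
  refine ⟨hm, ?_⟩
  have : IsProbabilityMeasure ((rowLaw Sig s).map fun z c => z (π c)) :=
    Measure.isProbabilityMeasure_map hm.aemeasurable
  refine Measure.ext_of_charFunDual ?_
  ext L
  obtain ⟨a, ha⟩ : ∃ a : Fin p ⊕ Fin p → ℝ, ⇑L = fun z => ∑ c, a c * z c := by
    refine ⟨fun c => L (Pi.single c 1), ?_⟩
    ext z
    conv_lhs => rw [pi_eq_sum_univ' z]
    rw [map_sum]
    refine Finset.sum_congr rfl fun c _ => ?_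
    rw [map_smul, smul_eq_mul, mul_comm]
  rw [charFunDual_eq_charFun_map_one, charFunDual_eq_charFun_map_one,
    Measure.map_map (by fun_prop) hm, ha]
  have e : (fun z : Fin p ⊕ Fin p → ℝ => ∑ c, a c * z c) ∘
      (fun (z : Fin p ⊕ Fin p → ℝ) c => z (π c)) =
      fun z => ∑ c, a (π.symm c) * z c := by
    ext z
    simp only [Function.comp]
    rw [← Equiv.sum_comp π fun c => a (π.symm c) * z c]
    simp
  rw [e, rowLaw_map_linear hG, rowLaw_map_linear hG]
  congr 3
  simp only [dotProduct, mulVec]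
  rw [← Equiv.sum_comp π]
  simp only [Equiv.symm_apply_apply]
  refine Finset.sum_congr rfl fun c _ => ?_
  congr 1
  rw [← Equiv.sum_comp π]
  simp [hπ]

lemma integral_gaussianReal_sq (v : ℝ≥0) : ∫ x, x ^ 2 ∂gaussianReal 0 v = v := by
  have h := variance_fun_id_gaussianReal (μ := 0) (v := v)
  rw [variance_of_integral_eq_zero (by fun_prop) (by simp)] at h
  exact h

lemma integrable_gaussianReal_sq (v : ℝ≥0) : Integrable (fun x => x ^ 2) (gaussianReal 0 v) :=
  (memLp_id_gaussianReal' 2 (by simp)).integrable_sq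

lemma integral_linear_sq_rowLaw (hG : (jointCov Sig s).PosSemidef) (a : Fin p ⊕ Fin p → ℝ) :
    ∫ z, (∑ c, a c * z c) ^ 2 ∂rowLaw Sig s = a ⬝ᵥ (jointCov Sig s *ᵥ a) := by
  have hm : Measurable fun z : Fin p ⊕ Fin p → ℝ => ∑ c, a c * z c := by fun_prop
  have h := integral_map (μ := rowLaw Sig s) (φ := fun z : Fin p ⊕ Fin p → ℝ => ∑ c, a c * z c)
    (f := fun x : ℝ => x ^ 2) hm.aemeasurable
    (Measurable.aestronglyMeasurable (by fun_prop))
  rw [← h, rowLaw_map_linear hG, integral_gaussianReal_sq, Real.coe_toNNReal]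
  simpa using hG.dotProduct_mulVec_nonneg a

lemma integrable_linear_sq_rowLaw (hG : (jointCov Sig s).PosSemidef) (a : Fin p ⊕ Fin p → ℝ) :
    Integrable (fun z => (∑ c, a c * z c) ^ 2) (rowLaw Sig s) := by
  have hm : Measurable fun z : Fin p ⊕ Fin p → ℝ => ∑ c, a c * z c := by fun_prop
  have h := integrable_map_measure (μ := rowLaw Sig s)
    (f := fun z : Fin p ⊕ Fin p → ℝ => ∑ c, a c * z c)
    (g := fun x : ℝ => x ^ 2)
    (Measurable.aestronglyMeasurable (by fun_prop)) hm.aemeasurable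
  rw [rowLaw_map_linear hG] at h
  exact h.1 (integrable_gaussianReal_sq _)

lemma ae_linear_eq_zero_rowLaw (hG : (jointCov Sig s).PosSemidef) {a : Fin p ⊕ Fin p → ℝ}
    (ha : a ⬝ᵥ (jointCov Sig s *ᵥ a) = 0) : ∀ᵐ z ∂rowLaw Sig s, ∑ c, a c * z c = 0 := by
  have h := integral_linear_sq_rowLaw hG a
  rw [ha, integral_eq_zero_iff_of_nonneg (fun z => sq_nonneg _)
    (integrable_linear_sq_rowLaw hG a)] at h
  filter_upwards [h] with z hz
  simpa using hz

end RowLaw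

/-! ### The symmetry and degeneracy attached to two features in one block. -/

section PairSymmetry

open Matrix

variable {p ℓ : ℕ} {block : Fin p → Fin ℓ} {ρ : Fin ℓ → ℝ} {s : Fin p → ℝ}

/-- Column permutation that swaps `a`, `b` with their knockoffs and exchanges the two features. -/
def pairPerm (a b : Fin p) : Equiv.Perm (Fin p ⊕ Fin p) :=
  (Equiv.swap (Sum.inl a) (Sum.inr b)).trans (Equiv.swap (Sum.inl b) (Sum.inr a))

lemma swapIdx_map_swap {a b : Fin p} (hab : a ≠ b) (c : Fin p ⊕ Fin p) :
    swapIdx {a, b} (Sum.map (Equiv.swap a b).symm (Equiv.swap a b).symm c) = pairPerm a b c := by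
  rcases c with c | c <;> by_cases ha : c = a <;> by_cases hb : c = b <;>
    simp_all [pairPerm, swapIdx, Equiv.swap_apply_def, eq_comm]

lemma IsSDPSolution.posSemidef_jointCov (hs : IsSDPSolution (blockEquicorr block ρ) s) :
    (jointCov (blockEquicorr block ρ) s).PosSemidef :=
  hs.1.posSemidef_jointCov (isHermitian_blockEquicorr block ρ)

/-- Features in a block are exchangeable because `s a = s b`, and exchanging features with knockoffs
never changes the covariance. -/
lemma jointCov_pairPerm (hρ : ∀ k, 1 / 2 ≤ ρ k ∧ ρ k ≤ 1)
    (hs : IsSDPSolution (blockEquicorr block ρ) s) {a b : Fin p} (hab : a ≠ b)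
    (hblock : block a = block b) (c d : Fin p ⊕ Fin p) :
    jointCov (blockEquicorr block ρ) s (pairPerm a b c) (pairPerm a b d) =
      jointCov (blockEquicorr block ρ) s c d := by
  have hs' := hs.eq_of_pair hρ hab hblock
  have hsab : s a = s b := hs'.1.trans hs'.2.symm
  set σ := Equiv.swap a b with hσ
  have hblockσ : ∀ i, block (σ i) = block i := fun i => by
    rw [hσ, Equiv.swap_apply_def]; split_ifs <;> simp_all
  have hsσ : ∀ i, s (σ i) = s i := fun i => by
    rw [hσ, Equiv.swap_apply_def]; split_ifs <;> simp_all
  have hSig : ∀ i j, blockEquicorr block ρ (σ i) (σ j) = blockEquicorr block ρ i j := fun i j => by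
    simp [blockEquicorr, hblockσ]
  have hdiag : ∀ i j, diagonal s (σ i) (σ j) = diagonal s i j := fun i j => by
    simp [diagonal_apply, hsσ]
  have hne : ∀ i j, i ≠ j → diagonal s (σ i) (σ j) = 0 := fun i j h => by
    rw [hdiag, diagonal_apply_ne _ h]
  rw [← swapIdx_map_swap hab, ← swapIdx_map_swap hab, Equiv.symm_swap]
  have hmem : ∀ i, σ i ∈ ({a, b} : Finset (Fin p)) ↔ i ∈ ({a, b} : Finset (Fin p)) := fun i => by
    rw [hσ, Equiv.swap_apply_def]; split_ifs <;> simp_all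
  rcases c with c | c <;> rcases d with d | d <;>
    by_cases hc : c ∈ ({a, b} : Finset (Fin p)) <;> by_cases hd : d ∈ ({a, b} : Finset (Fin p)) <;>
    simp only [Sum.map_inl, Sum.map_inr, swapIdx, ← hσ, hmem, hc, hd, if_true, if_false, jointCov,
      fromBlocks_apply₁₁, fromBlocks_apply₁₂, fromBlocks_apply₂₁, fromBlocks_apply₂₂,
      Matrix.sub_apply, hSig, hdiag] <;>
    -- When only one of the two columns is swapped, `Σ` is compared with `Σ - S`; they agree off the
    -- diagonal.
    (have hcd : c ≠ d := (by rintro rfl; contradiction)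
     simp [diagonal_apply_ne _ hcd])

/-- With `s = 2(1 - ρ)`, both sums have variance `4ρ` and their covariance is also `4ρ`, so the
difference has variance zero. -/
lemma ae_pair_sum_eq (hρ : ∀ k, 1 / 2 ≤ ρ k ∧ ρ k ≤ 1)
    (hs : IsSDPSolution (blockEquicorr block ρ) s) {a b : Fin p} (hab : a ≠ b)
    (hblock : block a = block b) :
    ∀ᵐ z ∂rowLaw (blockEquicorr block ρ) s,
      z (Sum.inl a) + z (Sum.inr a) = z (Sum.inl b) + z (Sum.inr b) := by
  have hs' := hs.eq_of_pair hρ hab hblock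
  have h := ae_linear_eq_zero_rowLaw hs.posSemidef_jointCov
    (a := Pi.single (Sum.inl a) 1 + Pi.single (Sum.inr a) 1 -
      (Pi.single (Sum.inl b) 1 + Pi.single (Sum.inr b) 1)) ?_
  · filter_upwards [h] with z hz
    simp [add_mul, sub_mul, Finset.sum_add_distrib, Pi.single_apply] at hz
    linarith
  · simp [mulVec_add, mulVec_sub, jointCov, blockEquicorr, hab, hab.symm, hblock, hs'.1, hs'.2,
      Matrix.sub_apply]
    ring

/-- The second moment is `2 - 2ρ`, at most `1` because `ρ ≥ 1/2`. -/
lemma integral_knockoff_sub_sq_le (hρ : ∀ k, 1 / 2 ≤ ρ k ∧ ρ k ≤ 1)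
    (hs : IsSDPSolution (blockEquicorr block ρ) s) {a b : Fin p} (hab : a ≠ b)
    (hblock : block a = block b) :
    Integrable (fun z => (z (Sum.inr a) - z (Sum.inl b)) ^ 2) (rowLaw (blockEquicorr block ρ) s) ∧
    ∫ z, (z (Sum.inr a) - z (Sum.inl b)) ^ 2 ∂rowLaw (blockEquicorr block ρ) s ≤ 1 := by
  have hs' := hs.eq_of_pair hρ hab hblock
  have e : (fun z : Fin p ⊕ Fin p → ℝ => (z (Sum.inr a) - z (Sum.inl b)) ^ 2) = fun z =>
      (∑ c, (Pi.single (Sum.inr a) 1 - Pi.single (Sum.inl b) 1 : Fin p ⊕ Fin p → ℝ) c * z c) ^ 2 := by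
    ext z
    simp [sub_mul, Pi.single_apply]
  rw [e, integral_linear_sq_rowLaw hs.posSemidef_jointCov]
  refine ⟨integrable_linear_sq_rowLaw hs.posSemidef_jointCov _, ?_⟩
  simp [mulVec_sub, jointCov, blockEquicorr, hab, hab.symm, hblock, Matrix.sub_apply]
  linarith [(hρ (block b)).1]

end PairSymmetry

/-! ### Stability of Gaussian means under a shift. -/

section GaussianShift

/-- Likelihood ratio of `N(h, v)` against `N(0, v)`. -/
noncomputable def shiftRatio (v : ℝ≥0) (h x : ℝ) : ℝ := Real.exp ((h * x - h ^ 2 / 2) / v)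

lemma shiftRatio_pos (v : ℝ≥0) (h x : ℝ) : 0 < shiftRatio v h x := Real.exp_pos _

lemma measurable_shiftRatio (v : ℝ≥0) (h : ℝ) : Measurable (shiftRatio v h) := by
  unfold shiftRatio; fun_prop

lemma gaussianReal_eq_withDensity {v : ℝ≥0} (hv : v ≠ 0) (h : ℝ) :
    gaussianReal h v = (gaussianReal 0 v).withDensity fun x => ENNReal.ofReal (shiftRatio v h x) := by
  have hv' : (v : ℝ) ≠ 0 := by exact_mod_cast hv
  rw [gaussianReal_of_var_ne_zero _ hv, gaussianReal_of_var_ne_zero _ hv,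
    ← withDensity_mul _ (by fun_prop) (by have := measurable_shiftRatio v h; fun_prop)]
  congr 1
  ext x
  simp only [Pi.mul_apply, gaussianPDF]
  rw [← ENNReal.ofReal_mul (gaussianPDFReal_nonneg _ _ _)]
  congr 1
  simp only [gaussianPDFReal, shiftRatio]
  rw [mul_assoc (√_)⁻¹, ← Real.exp_add]
  congr 2
  field_simp
  ring

lemma pi_withDensity {n : ℕ} {μ : Fin n → Measure ℝ} [∀ i, IsProbabilityMeasure (μ i)]
    {f : Fin n → ℝ → ℝ≥0∞} (hf : ∀ i, Measurable (f i))
    [∀ i, SigmaFinite ((μ i).withDensity (f i))] :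
    Measure.pi (fun i => (μ i).withDensity (f i)) =
      (Measure.pi μ).withDensity fun z => ∏ i, f i (z i) := by
  refine Measure.pi_eq (μ := fun i => (μ i).withDensity (f i)) fun s hs => ?_
  rw [withDensity_apply _ (MeasurableSet.univ_pi hs), ← lintegral_indicator
    (MeasurableSet.univ_pi hs)]
  have e : ∀ z : Fin n → ℝ, (Set.univ.pi s).indicator (fun z => ∏ i, f i (z i)) z =
      ∏ i, (s i).indicator (f i) (z i) := by
    intro z
    by_cases hz : z ∈ Set.univ.pi s
    · rw [Set.indicator_of_mem hz]
      exact Finset.prod_congr rfl fun i _ =>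
        (Set.indicator_of_mem (hz i (Set.mem_univ i)) _).symm
    · rw [Set.indicator_of_notMem hz]
      simp only [Set.mem_pi, Set.mem_univ, true_imp_iff, not_forall] at hz
      obtain ⟨i, hi⟩ := hz
      exact (Finset.prod_eq_zero (Finset.mem_univ i) (Set.indicator_of_notMem hi _)).symm
  simp_rw [e]
  have hm : ∀ i, Measurable ((s i).indicator (f i)) := fun i => (hf i).indicator (hs i)
  have hind : iIndepFun (fun i (z : Fin n → ℝ) => (s i).indicator (f i) (z i)) (Measure.pi μ) :=
    iIndepFun_pi fun i => (hm i).aemeasurable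
  rw [lintegral_prod_eq_prod_lintegral_of_indepFun Finset.univ _ hind
    fun i => (hm i).comp (measurable_pi_apply i)]
  refine Finset.prod_congr rfl fun i _ => ?_
  rw [withDensity_apply _ (hs i), ← lintegral_indicator (hs i),
    ← (measurePreserving_eval μ i).lintegral_comp (hm i)]

variable {n : ℕ}

/-- Likelihood ratio of a product Gaussian shifted by `h`. -/
noncomputable def prodRatio (v : ℝ≥0) (h z : Fin n → ℝ) : ℝ := ∏ i, shiftRatio v (h i) (z i)

lemma prodRatio_nonneg (v : ℝ≥0) (h z : Fin n → ℝ) : 0 ≤ prodRatio v h z :=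
  Finset.prod_nonneg fun _ _ => (shiftRatio_pos _ _ _).le

lemma measurable_prodRatio (v : ℝ≥0) (h : Fin n → ℝ) : Measurable (prodRatio v h) :=
  Finset.measurable_prod _ fun i _ => (measurable_shiftRatio v (h i)).comp (measurable_pi_apply i)

lemma map_add_pi_gaussianReal {v : ℝ≥0} (hv : v ≠ 0) (h : Fin n → ℝ) :
    (Measure.pi fun _ : Fin n => gaussianReal 0 v).map (fun z i => z i + h i) =
      (Measure.pi fun _ : Fin n => gaussianReal 0 v).withDensity
        fun z => ENNReal.ofReal (prodRatio v h z) := by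
  have h1 : (Measure.pi fun _ : Fin n => gaussianReal 0 v).map (fun z i => z i + h i) =
      Measure.pi fun i => gaussianReal (h i) v := by
    have hm := fun i => gaussianReal_map_add_const (μ := 0) (v := v) (h i)
    have hp : ∀ i, SigmaFinite ((gaussianReal 0 v).map (· + h i)) := fun i => by
      rw [hm i]; infer_instance
    rw [Measure.pi_map_pi (μ := fun _ : Fin n => gaussianReal 0 v) (f := fun i x => x + h i)
      fun i => Measurable.aemeasurable (by fun_prop)]
    simp [hm]
  have hi : ∀ i, IsProbabilityMeasure ((gaussianReal 0 v).withDensity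
      fun x => ENNReal.ofReal (shiftRatio v (h i) x)) := fun i => by
    rw [← gaussianReal_eq_withDensity hv]; infer_instance
  rw [h1]
  rw [show (fun i => gaussianReal (h i) v) = fun i => (gaussianReal 0 v).withDensity
    fun x => ENNReal.ofReal (shiftRatio v (h i) x) from
      funext fun i => gaussianReal_eq_withDensity hv (h i),
    pi_withDensity fun i => (measurable_shiftRatio v (h i)).ennreal_ofReal]
  congr 1
  ext z
  rw [prodRatio, ENNReal.ofReal_prod_of_nonneg fun i _ => (shiftRatio_pos _ _ _).le]

lemma integral_add_pi_gaussianReal {v : ℝ≥0} (hv : v ≠ 0) (h : Fin n → ℝ) {G : (Fin n → ℝ) → ℝ}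
    (hG : Measurable G) :
    ∫ z, G (fun i => z i + h i) ∂(Measure.pi fun _ : Fin n => gaussianReal 0 v) =
      ∫ z, prodRatio v h z * G z ∂(Measure.pi fun _ : Fin n => gaussianReal 0 v) := by
  have hm : Measurable fun (z : Fin n → ℝ) i => z i + h i := by fun_prop
  rw [← integral_map hm.aemeasurable hG.aestronglyMeasurable, map_add_pi_gaussianReal hv,
    integral_withDensity_eq_integral_toReal_smul (measurable_prodRatio v h).ennreal_ofReal
    (by simp)]
  simp [ENNReal.toReal_ofReal (prodRatio_nonneg _ _ _)]

lemma integral_shiftRatio_sq {v : ℝ≥0} (hv : v ≠ 0) (h : ℝ) :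
    ∫ x, shiftRatio v h x ^ 2 ∂gaussianReal 0 v = Real.exp (h ^ 2 / v) := by
  have hv' : (v : ℝ) ≠ 0 := by exact_mod_cast hv
  have h1 := congrFun (mgf_id_gaussianReal (μ := 0) (v := v)) (2 * h / v)
  simp only [mgf, id] at h1
  have e : ∀ x, shiftRatio v h x ^ 2 = Real.exp (2 * h / v * x) * Real.exp (-h ^ 2 / v) := by
    intro x
    rw [shiftRatio, ← Real.exp_nat_mul, ← Real.exp_add]
    congr 1; push_cast; ring
  simp_rw [e]
  rw [integral_mul_const, h1, ← Real.exp_add]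
  congr 1; field_simp; ring

lemma integrable_shiftRatio_sq (v : ℝ≥0) (h : ℝ) :
    Integrable (fun x => shiftRatio v h x ^ 2) (gaussianReal 0 v) := by
  have e : ∀ x, shiftRatio v h x ^ 2 = Real.exp (2 * h / v * x) * Real.exp (-h ^ 2 / v) := by
    intro x
    rw [shiftRatio, ← Real.exp_nat_mul, ← Real.exp_add]
    congr 1; push_cast; ring
  simp_rw [e]
  exact (integrable_exp_mul_gaussianReal _).mul_const _

lemma memLp_prodRatio (v : ℝ≥0) (h : Fin n → ℝ) :
    MemLp (prodRatio v h) 2 (Measure.pi fun _ : Fin n => gaussianReal 0 v) := by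
  rw [memLp_two_iff_integrable_sq (measurable_prodRatio v h).aestronglyMeasurable]
  have := Integrable.fintype_prod (μ := fun _ : Fin n => gaussianReal 0 v)
    (f := fun i x => shiftRatio v (h i) x ^ 2) fun i => integrable_shiftRatio_sq v (h i)
  simpa [prodRatio, Finset.prod_pow] using this

lemma integral_prodRatio_sq {v : ℝ≥0} (hv : v ≠ 0) (h : Fin n → ℝ) :
    ∫ z, prodRatio v h z ^ 2 ∂(Measure.pi fun _ : Fin n => gaussianReal 0 v) =
      Real.exp ((∑ i, h i ^ 2) / v) := by
  simp_rw [prodRatio, ← Finset.prod_pow]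
  rw [integral_fintype_prod_eq_prod (fun i x => shiftRatio v (h i) x ^ 2)]
  simp_rw [integral_shiftRatio_sq hv]
  rw [← Real.exp_sum, Finset.sum_div]

lemma integral_prodRatio {v : ℝ≥0} (hv : v ≠ 0) (h : Fin n → ℝ) :
    ∫ z, prodRatio v h z ∂(Measure.pi fun _ : Fin n => gaussianReal 0 v) = 1 := by
  have := integral_add_pi_gaussianReal hv h (G := fun _ => 1) measurable_const
  simpa using this.symm

/-- Shifting the argument of a bounded function changes its Gaussian mean by at most a multiple of
the length of the shift, in units of the standard deviation. -/
lemma abs_integral_sub_shift_le {v : ℝ≥0} (hv : v ≠ 0) (h : Fin n → ℝ) {G : (Fin n → ℝ) → ℝ}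
    (hG : Measurable G) (hG1 : ∀ z, |G z| ≤ 1) :
    |∫ z, G z ∂(Measure.pi fun _ : Fin n => gaussianReal 0 v) -
      ∫ z, G (fun i => z i + h i) ∂(Measure.pi fun _ : Fin n => gaussianReal 0 v)| ≤
      2 * √((∑ i, h i ^ 2) / v) := by
  set γ := Measure.pi fun _ : Fin n => gaussianReal 0 v with hγ
  set X := (∑ i, h i ^ 2) / (v : ℝ) with hX
  have hX0 : 0 ≤ X := by positivity
  have hGi : Integrable G γ := Integrable.of_bound hG.aestronglyMeasurable 1
    (ae_of_all _ fun z => by simpa using hG1 z)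
  have hLp := memLp_prodRatio v h
  have hLi : Integrable (prodRatio v h) γ := hLp.integrable (by norm_num)
  have hLGi : Integrable (fun z => prodRatio v h z * G z) γ :=
    hLi.mul_bdd (c := 1) hG.aestronglyMeasurable (ae_of_all _ fun z => by simpa using hG1 z)
  have hone : Integrable (fun _ : Fin n → ℝ => (1 : ℝ)) γ := integrable_const _
  rcases le_or_gt X 1 with hX1 | hX1
  · rw [integral_add_pi_gaussianReal hv h hG, ← integral_sub hGi hLGi]
    have hd : MemLp (fun z => 1 - prodRatio v h z) 2 γ := (memLp_const 1).sub hLp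
    have h1 : |∫ z, G z - prodRatio v h z * G z ∂γ| ≤ ∫ z, |1 - prodRatio v h z| ∂γ := by
      refine abs_integral_le_integral_abs.trans (integral_mono_of_nonneg
        (ae_of_all _ fun z => abs_nonneg _) (hone.sub hLi).abs (ae_of_all _ fun z => ?_))
      have : G z - prodRatio v h z * G z = (1 - prodRatio v h z) * G z := by ring
      simp only [this, abs_mul]
      exact mul_le_of_le_one_right (abs_nonneg _) (hG1 z)
    -- Total variation is controlled by the chi-square distance, here `exp X - 1`.
    have h2 : (∫ z, |1 - prodRatio v h z| ∂γ) ^ 2 ≤ ∫ z, (1 - prodRatio v h z) ^ 2 ∂γ := by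
      have hvar := variance_nonneg (fun z => |1 - prodRatio v h z|) γ
      have habs : MemLp (fun z => |1 - prodRatio v h z|) 2 γ := hd.abs
      rw [variance_eq_sub habs] at hvar
      simp only [Pi.pow_apply, sq_abs] at hvar
      linarith
    have h3 : ∫ z, (1 - prodRatio v h z) ^ 2 ∂γ = Real.exp X - 1 := by
      have e : ∀ z, (1 - prodRatio v h z) ^ 2 = 1 - 2 * prodRatio v h z + prodRatio v h z ^ 2 :=
        fun z => by ring
      simp_rw [e]
      have hi2 : Integrable (fun z => 2 * prodRatio v h z) γ := hLi.const_mul 2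
      have hi12 : Integrable (fun z => 1 - 2 * prodRatio v h z) γ := hone.sub hi2
      rw [integral_add hi12 hLp.integrable_sq, integral_sub hone hi2, integral_const_mul,
        integral_prodRatio hv,
        integral_prodRatio_sq hv]
      simp; ring
    have h4 : Real.exp X - 1 ≤ 4 * X := by
      have := Real.abs_exp_sub_one_le (x := X) (by rwa [abs_of_nonneg hX0])
      rw [abs_of_nonneg hX0] at this
      linarith [le_abs_self (Real.exp X - 1)]
    have h5 : 2 * √X = √(4 * X) := by
      rw [Real.sqrt_mul (by norm_num), show (4 : ℝ) = 2 ^ 2 by norm_num,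
        Real.sqrt_sq (by norm_num)]
    rw [h5]
    exact h1.trans (Real.le_sqrt_of_sq_le (h2.trans (h3.le.trans h4)))
  -- For `X > 1` the trivial bound `2` suffices.
  · have hb : ∀ F : (Fin n → ℝ) → ℝ, (∀ z, |F z| ≤ 1) → |∫ z, F z ∂γ| ≤ 1 := by
      intro F hF
      have := norm_integral_le_of_norm_le_const (μ := γ) (f := F) (ae_of_all _ hF)
      simpa using this
    have h1 := hb G hG1
    have h2 := hb (fun z => G fun i => z i + h i) fun z => hG1 _
    have h3 : 1 ≤ √X := Real.one_le_sqrt.2 hX1.le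
    refine (abs_sub _ _).trans ?_
    linarith

end GaussianShift

lemma integral_sqrt_le {α : Type*} [MeasurableSpace α] {μ : Measure α} [IsProbabilityMeasure μ]
    {Y : α → ℝ} (hY : Measurable Y) (hY0 : ∀ x, 0 ≤ Y x) (hi : Integrable Y μ) :
    ∫ x, √(Y x) ∂μ ≤ √(∫ x, Y x ∂μ) := by
  have hLp : MemLp (fun x => √(Y x)) 2 μ := by
    rw [memLp_two_iff_integrable_sq hY.sqrt.aestronglyMeasurable]
    simpa [Real.sq_sqrt (hY0 _)] using hi
  have hvar := variance_nonneg (fun x => √(Y x)) μ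
  rw [variance_eq_sub hLp] at hvar
  simp only [Pi.pow_apply, Real.sq_sqrt (hY0 _)] at hvar
  exact Real.le_sqrt_of_sq_le (by linarith)

lemma integral_bind_kernel {α β : Type*} [MeasurableSpace α] [MeasurableSpace β] {μ : Measure α}
    [IsProbabilityMeasure μ] {κ : Kernel α β} [IsMarkovKernel κ] {f : β → ℝ}
    (hf : Integrable f (μ.bind κ)) : ∫ y, f y ∂(μ.bind κ) = ∫ x, ∫ y, f y ∂κ x ∂μ := by
  have h := Kernel.integral_comp (κ := Kernel.const Unit μ) (η := κ) (a := ()) (f := f)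
  rw [Kernel.comp_apply, Kernel.const_apply] at h
  exact h hf

/-! ### Near-symmetry of the data and the bound on expected discoveries. -/

section DataLaw

variable {n p : ℕ}

/-- The linear predictor `𝐗 β`. -/
def linPred (β : Fin p → ℝ) (X : Fin n → Fin p ⊕ Fin p → ℝ) : Fin n → ℝ :=
  fun i => ∑ j, X i (Sum.inl j) * β j

/-- The law of the noise `(ζ, U)`. -/
noncomputable def noiseLaw (n : ℕ) (v : ℝ≥0) : Measure ((Fin n → ℝ) × (Fin n → ℝ)) :=
  (Measure.pi fun _ : Fin n => gaussianReal 0 v).prod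
    (Measure.pi fun _ : Fin n => (volume : Measure ℝ).restrict (Set.Ioo 0 1))

instance isProbabilityMeasure_uniform :
    IsProbabilityMeasure ((volume : Measure ℝ).restrict (Set.Ioo 0 1)) :=
  ⟨by simp⟩

instance (v : ℝ≥0) : IsProbabilityMeasure (noiseLaw n v) := by
  unfold noiseLaw; infer_instance

lemma measurable_response {f : ℝ → ℝ → ℝ} (hf : Measurable (Function.uncurry f)) :
    Measurable fun ω : (Fin n → ℝ) × (Fin n → ℝ) × (Fin n → ℝ) =>
      fun i => f (ω.1 i + ω.2.1 i) (ω.2.2 i) := by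
  refine measurable_pi_lambda _ fun i => ?_
  exact hf.comp (f := fun ω : (Fin n → ℝ) × (Fin n → ℝ) × (Fin n → ℝ) =>
    (ω.1 i + ω.2.1 i, ω.2.2 i)) (by fun_prop)

lemma measurable_linPred (β : Fin p → ℝ) : Measurable (linPred (n := n) β) := by
  unfold linPred; fun_prop

/-- The mean of `Ψ` given the design and the linear predictor `m`. -/
noncomputable def condMean (v : ℝ≥0) (f : ℝ → ℝ → ℝ) (Ψ : Data n p → ℝ)
    (X : Fin n → Fin p ⊕ Fin p → ℝ) (m : Fin n → ℝ) : ℝ :=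
  ∫ ω, Ψ (X, fun i => f (m i + ω.1 i) (ω.2 i)) ∂noiseLaw n v

variable {f : ℝ → ℝ → ℝ} {Ψ : Data n p → ℝ} {v : ℝ≥0}

lemma measurable_integrand (hf : Measurable (Function.uncurry f)) (hΨ : Measurable Ψ) :
    Measurable fun ω : (Fin n → Fin p ⊕ Fin p → ℝ) × (Fin n → ℝ) × (Fin n → ℝ) × (Fin n → ℝ) =>
      Ψ (ω.1, fun i => f (ω.2.1 i + ω.2.2.1 i) (ω.2.2.2 i)) :=
  hΨ.comp (measurable_fst.prodMk ((measurable_response hf).comp measurable_snd))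

lemma measurable_condMean (hf : Measurable (Function.uncurry f)) (hΨ : Measurable Ψ)
    {m : (Fin n → Fin p ⊕ Fin p → ℝ) → Fin n → ℝ} (hm : Measurable m) :
    Measurable fun X => condMean v f Ψ X (m X) := by
  have h : Measurable fun ω : (Fin n → Fin p ⊕ Fin p → ℝ) × (Fin n → ℝ) × (Fin n → ℝ) =>
      Ψ (ω.1, fun i => f (m ω.1 i + ω.2.1 i) (ω.2.2 i)) :=
    (measurable_integrand hf hΨ).comp
      (measurable_fst.prodMk ((hm.comp measurable_fst).prodMk measurable_snd))
  exact (h.stronglyMeasurable.integral_prod_right' (ν := noiseLaw n v)).measurable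

lemma abs_condMean_le (hΨ1 : ∀ d, |Ψ d| ≤ 1) (X : Fin n → Fin p ⊕ Fin p → ℝ) (m : Fin n → ℝ) :
    |condMean v f Ψ X m| ≤ 1 := by
  have := norm_integral_le_of_norm_le_const (μ := noiseLaw n v)
    (f := fun ω => Ψ (X, fun i => f (m i + ω.1 i) (ω.2 i))) (ae_of_all _ fun ω => hΨ1 _)
  simpa [condMean] using this

/-- With the design and `U` fixed, a change of linear predictor is a shift of `ζ`; `f` and `Ψ` need
only be measurable. -/
lemma abs_condMean_sub_le (hf : Measurable (Function.uncurry f)) (hΨ : Measurable Ψ)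
    (hΨ1 : ∀ d, |Ψ d| ≤ 1) (hv : v ≠ 0) (X : Fin n → Fin p ⊕ Fin p → ℝ) (m h : Fin n → ℝ) :
    |condMean v f Ψ X m - condMean v f Ψ X (fun i => m i + h i)| ≤
      2 * √((∑ i, h i ^ 2) / v) := by
  set γ := Measure.pi fun _ : Fin n => gaussianReal 0 v
  set U := Measure.pi fun _ : Fin n => (volume : Measure ℝ).restrict (Set.Ioo 0 1)
  have hmeas : ∀ m : Fin n → ℝ, Measurable fun ω : (Fin n → ℝ) × (Fin n → ℝ) =>
      Ψ (X, fun i => f (m i + ω.1 i) (ω.2 i)) := fun m =>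
    (measurable_integrand hf hΨ).comp
      (measurable_const.prodMk (measurable_const.prodMk measurable_id))
  have hint : ∀ m : Fin n → ℝ, Integrable (fun ω : (Fin n → ℝ) × (Fin n → ℝ) =>
      Ψ (X, fun i => f (m i + ω.1 i) (ω.2 i))) (γ.prod U) := fun m =>
    Integrable.of_bound (hmeas m).aestronglyMeasurable 1 (ae_of_all _ fun ω => hΨ1 _)
  unfold condMean noiseLaw
  rw [integral_prod_symm _ (hint m), integral_prod_symm _ (hint fun i => m i + h i),
    ← integral_sub (hint m).integral_prod_right (hint fun i => m i + h i).integral_prod_right]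
  have hpt : ∀ u : Fin n → ℝ, ‖∫ z, Ψ (X, fun i => f (m i + z i) (u i)) ∂γ -
      ∫ z, Ψ (X, fun i => f (m i + h i + z i) (u i)) ∂γ‖ ≤ 2 * √((∑ i, h i ^ 2) / v) := by
    intro u
    have := abs_integral_sub_shift_le hv h
      (G := fun z => Ψ (X, fun i => f (m i + z i) (u i)))
      ((hmeas m).comp (measurable_id.prodMk measurable_const)) fun z => hΨ1 _
    simp only [add_assoc, add_comm (h _)]
    exact this
  have := norm_integral_le_of_norm_le_const (μ := U) (ae_of_all _ hpt)
  simpa using this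

lemma integral_dataLaw {Sig : Matrix (Fin p) (Fin p) ℝ} {s β : Fin p → ℝ}
    (hf : Measurable (Function.uncurry f)) (hΨ : Measurable Ψ) (hΨ1 : ∀ d, |Ψ d| ≤ 1) :
    ∫ d, Ψ d ∂dataLaw n Sig s v f β =
      ∫ X, condMean v f Ψ X (linPred β X) ∂Measure.pi fun _ : Fin n => rowLaw Sig s := by
  have hmap : Measurable fun ω : (Fin n → Fin p ⊕ Fin p → ℝ) × (Fin n → ℝ) × (Fin n → ℝ) =>
      ((ω.1, fun i => f ((∑ j, ω.1 i (Sum.inl j) * β j) + ω.2.1 i) (ω.2.2 i)) : Data n p) :=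
    measurable_fst.prodMk ((measurable_response hf).comp
      (((measurable_linPred β).comp measurable_fst).prodMk measurable_snd))
  rw [dataLaw, integral_map hmap.aemeasurable hΨ.aestronglyMeasurable]
  exact integral_prod (μ := Measure.pi fun _ : Fin n => rowLaw Sig s) (ν := noiseLaw n v) _
    (Integrable.of_bound (hΨ.comp hmap).aestronglyMeasurable 1 (ae_of_all _ fun ω => hΨ1 _))

lemma isProbabilityMeasure_dataLaw {Sig : Matrix (Fin p) (Fin p) ℝ} {s β : Fin p → ℝ}
    (hf : Measurable (Function.uncurry f)) : IsProbabilityMeasure (dataLaw n Sig s v f β) := by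
  have hmap : Measurable fun ω : (Fin n → Fin p ⊕ Fin p → ℝ) × (Fin n → ℝ) × (Fin n → ℝ) =>
      ((ω.1, fun i => f ((∑ j, ω.1 i (Sum.inl j) * β j) + ω.2.1 i) (ω.2.2 i)) : Data n p) :=
    measurable_fst.prodMk ((measurable_response hf).comp
      (((measurable_linPred β).comp measurable_fst).prodMk measurable_snd))
  exact Measure.isProbabilityMeasure_map hmap.aemeasurable

/-- The data after swapping `a` and `b` with their knockoffs and exchanging the two features. -/
def flipData (a b : Fin p) (d : Data n p) : Data n p :=
  (fun i c => d.1 i (pairPerm a b c), d.2)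

lemma permData_swapData {a b : Fin p} (hab : a ≠ b) (d : Data n p) :
    permData (Equiv.swap a b) (swapData {a, b} d) = flipData a b d := by
  simp only [permData, swapData, flipData, swapIdx_map_swap hab]

/-- By the degeneracy, `X̃_b - X_a = X̃_a - X_b`, so the two coefficients multiply the same
increment. -/
lemma linPred_flip {a b : Fin p} (hab : a ≠ b) (β : Fin p → ℝ) (X : Fin n → Fin p ⊕ Fin p → ℝ)
    (hX : ∀ i, X i (Sum.inl a) + X i (Sum.inr a) = X i (Sum.inl b) + X i (Sum.inr b)) :
    linPred β (fun i c => X i (pairPerm a b c)) = fun i => linPred β X i +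
      (β a + β b) * (X i (Sum.inr a) - X i (Sum.inl b)) := by
  funext i
  simp only [linPred]
  have ha : pairPerm a b (Sum.inl a) = Sum.inr b := by
    simp [pairPerm, Equiv.swap_apply_def, hab.symm]
  have hb : pairPerm a b (Sum.inl b) = Sum.inr a := by
    simp [pairPerm, Equiv.swap_apply_def, hab.symm]
  have hc : ∀ c, c ≠ a → c ≠ b → pairPerm a b (Sum.inl c) = Sum.inl c := fun c h1 h2 => by
    simp [pairPerm, Equiv.swap_apply_def, h1, h2]
  have hb' : b ∈ Finset.univ.erase a := Finset.mem_erase.2 ⟨hab.symm, Finset.mem_univ b⟩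
  rw [← Finset.add_sum_erase _ _ (Finset.mem_univ a), ← Finset.add_sum_erase _ _ hb',
    ← Finset.add_sum_erase (f := fun j => X i (Sum.inl j) * β j) _ (Finset.mem_univ a),
    ← Finset.add_sum_erase (f := fun j => X i (Sum.inl j) * β j) _ hb', ha, hb]
  have : ∑ x ∈ (Finset.univ.erase a).erase b, X i (pairPerm a b (Sum.inl x)) * β x =
      ∑ x ∈ (Finset.univ.erase a).erase b, X i (Sum.inl x) * β x :=
    Finset.sum_congr rfl fun x hx => by
      rw [hc x (Finset.ne_of_mem_erase (Finset.mem_of_mem_erase hx)) (Finset.ne_of_mem_erase hx)]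
  rw [this]
  linear_combination (-β a) * hX i

variable {ℓ : ℕ} {block : Fin p → Fin ℓ} {ρ : Fin ℓ → ℝ} {s : Fin p → ℝ}

/-- A bounded statistic that is odd under the flip of a pair of features in one block has a mean of
order `√n |β_a + β_b|`. -/
lemma abs_integral_odd_le (hρ : ∀ k, 1 / 2 ≤ ρ k ∧ ρ k ≤ 1)
    (hs : IsSDPSolution (blockEquicorr block ρ) s) (β : Fin p → ℝ) {a b : Fin p} (hab : a ≠ b)
    (hblock : block a = block b) (hf : Measurable (Function.uncurry f)) (hΨ : Measurable Ψ)
    (hΨ1 : ∀ d, |Ψ d| ≤ 1) (hv : v ≠ 0) (hodd : ∀ d, Ψ (flipData a b d) = -Ψ d) :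
    |∫ d, Ψ d ∂dataLaw n (blockEquicorr block ρ) s v f β| ≤ √n * |β a + β b| / √v := by
  set D := Measure.pi fun _ : Fin n => rowLaw (blockEquicorr block ρ) s with hD
  have hv0 : (0 : ℝ) < v := by exact_mod_cast pos_iff_ne_zero.2 hv
  set flip : (Fin n → Fin p ⊕ Fin p → ℝ) → Fin n → Fin p ⊕ Fin p → ℝ :=
    fun X i c => X i (pairPerm a b c) with hflip
  have hmp : MeasurePreserving flip D D :=
    measurePreserving_pi _ _ fun _ => measurePreserving_rowLaw_comp hs.posSemidef_jointCov
      (pairPerm a b) (jointCov_pairPerm hρ hs hab hblock)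
  set Y : (Fin n → Fin p ⊕ Fin p → ℝ) → ℝ := fun X =>
    (∑ i, ((β a + β b) * (X i (Sum.inr a) - X i (Sum.inl b))) ^ 2) / v with hY
  have hsq := integral_knockoff_sub_sq_le hρ hs hab hblock
  have hrow : ∀ i : Fin n, Integrable
      (fun X => ((β a + β b) * (X i (Sum.inr a) - X i (Sum.inl b))) ^ 2) D := fun i => by
    simp_rw [mul_pow]
    exact ((measurePreserving_eval
      (fun _ : Fin n => rowLaw (blockEquicorr block ρ) s) i).integrable_comp_of_integrable
        hsq.1).const_mul _
  have hYi : Integrable Y D := (integrable_finsetSum _ fun i _ => hrow i).div_const _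
  have hYm : Measurable Y := by rw [hY]; fun_prop
  have hY0 : ∀ X, 0 ≤ Y X := fun X => by rw [hY]; positivity
  have hYint : ∫ X, Y X ∂D ≤ n * (β a + β b) ^ 2 / v := by
    rw [hY, integral_div, integral_finsetSum _ fun i _ => hrow i]
    gcongr
    calc _ ≤ ∑ i : Fin n, (β a + β b) ^ 2 := by
          refine Finset.sum_le_sum fun i _ => ?_
          simp_rw [mul_pow]
          rw [integral_const_mul]
          have e := (measurePreserving_eval
            (fun _ : Fin n => rowLaw (blockEquicorr block ρ) s) i).map_eq
          have e2 := integral_map (μ := D) (φ := Function.eval i)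
            (f := fun z : Fin p ⊕ Fin p → ℝ => (z (Sum.inr a) - z (Sum.inl b)) ^ 2)
            (measurable_pi_apply i).aemeasurable
            (Measurable.aestronglyMeasurable (by fun_prop))
          rw [e] at e2
          have e3 : ∫ X, (X i (Sum.inr a) - X i (Sum.inl b)) ^ 2 ∂D ≤ 1 := e2.symm.trans_le hsq.2
          exact mul_le_of_le_one_right (sq_nonneg _) e3
      _ = _ := by simp
  -- Oddness applies with the response held fixed, so the design is flipped but the predictor `m` is
  -- not.
  have hK : ∀ X m, condMean v f Ψ (flip X) m = -condMean v f Ψ X m := fun X m => by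
    rw [condMean, condMean, ← integral_neg]
    exact integral_congr_ae (ae_of_all _ fun ω => hodd (X, fun i => f (m i + ω.1 i) (ω.2 i)))
  have hmK : ∀ {m : (Fin n → Fin p ⊕ Fin p → ℝ) → Fin n → ℝ}, Measurable m →
      Integrable (fun X => condMean v f Ψ X (m X)) D := fun hm =>
    Integrable.of_bound (measurable_condMean hf hΨ hm).aestronglyMeasurable 1
      (ae_of_all _ fun X => abs_condMean_le hΨ1 _ _)
  have hI1 := hmK (measurable_linPred β)
  have hI2 : Integrable (fun X => condMean v f Ψ X (linPred β (flip X))) D :=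
    hmK ((measurable_linPred β).comp hmp.measurable)
  set I := ∫ X, condMean v f Ψ X (linPred β X) ∂D with hI
  -- Invariance of the design law moves the flip onto the predictor; hence `2I` is the mean effect
  -- of a small shift of the predictor.
  have hIflip : I = -∫ X, condMean v f Ψ X (linPred β (flip X)) ∂D := by
    have h := integral_map (μ := D) (φ := flip) (f := fun X => condMean v f Ψ X (linPred β X))
      hmp.measurable.aemeasurable
      (measurable_condMean hf hΨ (measurable_linPred β)).aestronglyMeasurable
    rw [hmp.map_eq] at h
    rw [hI, h, ← integral_neg]
    simp_rw [hK]
  have hae : ∀ᵐ X ∂D, ∀ i,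
      X i (Sum.inl a) + X i (Sum.inr a) = X i (Sum.inl b) + X i (Sum.inr b) := by
    rw [ae_all_iff]
    intro i
    exact (measurePreserving_eval (fun _ : Fin n => rowLaw (blockEquicorr block ρ) s)
      i).quasiMeasurePreserving.ae (ae_pair_sum_eq hρ hs hab hblock)
  have h2I : 2 * |I| ≤ 2 * ∫ X, √(Y X) ∂D := by
    have e : 2 * I = ∫ X, condMean v f Ψ X (linPred β X) -
        condMean v f Ψ X (linPred β (flip X)) ∂D := by
      rw [integral_sub hI1 hI2, ← hI]
      linarith
    rw [← abs_two, ← abs_mul, e, abs_two, ← integral_const_mul]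
    have hsqrt : Integrable (fun X => √(Y X)) D := by
      refine (hYi.add (integrable_const (1 : ℝ))).mono' hYm.sqrt.aestronglyMeasurable
        (ae_of_all _ fun X => ?_)
      rw [Real.norm_of_nonneg (Real.sqrt_nonneg _)]
      refine Real.sqrt_le_iff.2 ⟨add_nonneg (hY0 X) zero_le_one, ?_⟩
      simp only [Pi.add_apply]
      nlinarith [hY0 X]
    refine abs_integral_le_integral_abs.trans (integral_mono_ae (hI1.sub hI2).abs
      (hsqrt.const_mul 2) ?_)
    filter_upwards [hae] with X hX
    have := abs_condMean_sub_le hf hΨ hΨ1 hv X (linPred β X)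
      (fun i => (β a + β b) * (X i (Sum.inr a) - X i (Sum.inl b)))
    rw [← linPred_flip hab β X hX] at this
    exact this
  rw [integral_dataLaw hf hΨ hΨ1]
  calc |I| ≤ ∫ X, √(Y X) ∂D := by linarith
    _ ≤ √(∫ X, Y X ∂D) := integral_sqrt_le hYm hY0 hYi
    _ ≤ √(n * (β a + β b) ^ 2 / v) := Real.sqrt_le_sqrt hYint
    _ = _ := by
      rw [Real.sqrt_div' _ hv0.le, Real.sqrt_mul' _ (sq_nonneg _), Real.sqrt_sq_eq_abs]

lemma measurable_flipPair (a b : Fin p) : Measurable (flipPair a b) := by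
  refine measurable_pi_lambda _ fun j => ?_
  simp only [flipPair, permStat, flipSigns]
  split_ifs <;> fun_prop

lemma IsPermInvariantStat.map_flipPair {w : Kernel (Data n p) (Fin p → ℝ)}
    (hw : IsPermInvariantStat w) {a b : Fin p} (hab : a ≠ b) (d : Data n p) :
    w (flipData a b d) = (w d).map (flipPair a b) := by
  have h1 : Measurable (flipSigns (p := p) {a, b}) := by
    refine measurable_pi_lambda _ fun j => ?_
    simp only [flipSigns]
    split_ifs <;> fun_prop
  have h2 : Measurable (permStat (Equiv.swap a b)) :=
    measurable_pi_lambda _ fun j => by simp only [permStat]; fun_prop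
  rw [← permData_swapData hab, hw.perm, hw.swap, Measure.map_map h2 h1]
  rfl

/-- The flux of a pair has a small mean. -/
lemma integral_pairFlux_le (hρ : ∀ k, 1 / 2 ≤ ρ k ∧ ρ k ≤ 1)
    (hs : IsSDPSolution (blockEquicorr block ρ) s) (β : Fin p → ℝ)
    (hf : Measurable (Function.uncurry f)) (hv : v ≠ 0) {w : Kernel (Data n p) (Fin p → ℝ)}
    (hw : IsPermInvariantStat w) {M : ℕ} {g₁ g₂ : Fin M → Fin p}
    (hg : Function.Injective (Sum.elim g₁ g₂)) (i : Fin M)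
    (hblock : block (g₁ i) = block (g₂ i)) :
    Integrable (pairFlux g₁ g₂ i) ((dataLaw n (blockEquicorr block ρ) s v f β).bind w) ∧
    ∫ W, pairFlux g₁ g₂ i W ∂((dataLaw n (blockEquicorr block ρ) s v f β).bind w) ≤
      √n * |β (g₁ i) + β (g₂ i)| / √v := by
  have := hw.markov
  have := isProbabilityMeasure_dataLaw (n := n) (v := v) (Sig := blockEquicorr block ρ) (s := s)
    (β := β) hf
  have hab : g₁ i ≠ g₂ i := fun h => by simpa using @hg (.inl i) (.inr i) h
  have hm := measurable_pairFlux g₁ g₂ i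
  have hi : Integrable (pairFlux g₁ g₂ i) ((dataLaw n (blockEquicorr block ρ) s v f β).bind w) :=
    Integrable.of_bound hm.aestronglyMeasurable 1 (ae_of_all _ fun W => abs_pairFlux_le _ _ _ _)
  refine ⟨hi, ?_⟩
  rw [integral_bind_kernel hi]
  refine (le_abs_self _).trans (abs_integral_odd_le hρ hs β hab hblock hf
    (Ψ := fun d => ∫ W, pairFlux g₁ g₂ i W ∂w d) ?_ (fun d => ?_) hv fun d => ?_)
  · exact hm.stronglyMeasurable.integral_kernel.measurable
  · have := norm_integral_le_of_norm_le_const (μ := w d)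
      (f := pairFlux g₁ g₂ i) (ae_of_all _ fun W => abs_pairFlux_le g₁ g₂ i W)
    simpa using this
  · rw [hw.map_flipPair hab, integral_map (measurable_flipPair _ _).aemeasurable
      hm.aestronglyMeasurable, ← integral_neg]
    simp_rw [pairFlux_flipPair hg]

/-- Bound on the expected number of discoveries, in terms of disjoint pairs of features. -/
lemma exists_expectedDiscoveries_le : ∃ C : ℝ, 0 ≤ C ∧ ∀ {n p ℓ : ℕ} {block : Fin p → Fin ℓ}
    {ρ : Fin ℓ → ℝ} {s : Fin p → ℝ} {f : ℝ → ℝ → ℝ} {v : ℝ≥0} (q : ℝ) (β : Fin p → ℝ)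
    {w : Kernel (Data n p) (Fin p → ℝ)} {M M' : ℕ} {g₁ g₂ : Fin M → Fin p},
    q ≤ 1 / 10 → (∀ k, 1 / 2 ≤ ρ k ∧ ρ k ≤ 1) → IsSDPSolution (blockEquicorr block ρ) s →
    Measurable (Function.uncurry f) → v ≠ 0 → IsPermInvariantStat w →
    Function.Injective (Sum.elim g₁ g₂) → (∀ i, block (g₁ i) = block (g₂ i)) →
    M' + 2 * M = p →
    expectedDiscoveries q (dataLaw n (blockEquicorr block ρ) s v f β) w ≤
      24 * ∑ i, √n * |β (g₁ i) + β (g₂ i)| / √v + C + 3 * M' := by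
  obtain ⟨C, hC0, hC⟩ := exists_card_selected_le
  refine ⟨C, hC0, fun {n p ℓ block ρ s f v} q β {w M M' g₁ g₂} hq hρ hs hf hv hw hg hblock hM => ?_⟩
  have := hw.markov
  have := isProbabilityMeasure_dataLaw (n := n) (v := v) (Sig := blockEquicorr block ρ) (s := s)
    (β := β) hf
  set ν := (dataLaw n (blockEquicorr block ρ) s v f β).bind w with hν
  have hflux := fun i => integral_pairFlux_le (n := n) hρ hs β hf hv hw hg i (hblock i)
  have hprob : IsProbabilityMeasure ν := inferInstanceAs (IsProbabilityMeasure (w ∘ₘ _))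
  have hsum : Integrable (fun W => 24 * ∑ i, pairFlux g₁ g₂ i W) ν :=
    (integrable_finsetSum _ fun i _ => (hflux i).1).const_mul _
  have hc : Integrable (fun _ : Fin p → ℝ => C) ν := integrable_const _
  have hc' : Integrable (fun _ : Fin p → ℝ => 3 * (M' : ℝ)) ν := integrable_const _
  have hsc : Integrable (fun W => 24 * ∑ i, pairFlux g₁ g₂ i W + C) ν := hsum.add hc
  calc expectedDiscoveries q (dataLaw n (blockEquicorr block ρ) s v f β) w
      ≤ ∫ W, 24 * ∑ i, pairFlux g₁ g₂ i W + C + 3 * M' ∂ν :=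
        integral_mono_of_nonneg (ae_of_all _ fun W => Nat.cast_nonneg _) (hsc.add hc')
          (ae_of_all _ fun W => hC q g₁ g₂ W hq hg hM)
    _ = 24 * ∑ i, ∫ W, pairFlux g₁ g₂ i W ∂ν + C + 3 * M' := by
        rw [integral_add hsc hc', integral_add hsum hc, integral_const_mul,
          integral_finsetSum _ fun i _ => (hflux i).1]
        simp [hν]
    _ ≤ _ := by
        gcongr with i
        exact (hflux i).2

end DataLaw

/-! ### Matching of opposite signs. -/

/-- Inside each class, match indices of opposite sign; the number of unmatched indices is the total
imbalance of the classes. -/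
lemma exists_opposite_pairs {ι κ : Type*} [DecidableEq ι] [Fintype κ] [DecidableEq κ] (c : ι → κ)
    (e : ι → ℝ) (U : Finset ι) (he : ∀ j ∈ U, e j = 1 ∨ e j = -1) :
    ∃ (M : ℕ) (g₁ g₂ : Fin M → ι), Function.Injective (Sum.elim g₁ g₂) ∧
      (∀ i, g₁ i ∈ U) ∧ (∀ i, g₂ i ∈ U) ∧ (∀ i, c (g₁ i) = c (g₂ i)) ∧
      (∀ i, e (g₁ i) + e (g₂ i) = 0) ∧
      (U.card : ℝ) ≤ 2 * M + ∑ k, |∑ j ∈ U, if c j = k then e j else 0| := by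
  induction U using Finset.strongInduction with
  | H U ih =>
  by_cases hex : ∃ i ∈ U, ∃ j ∈ U, c i = c j ∧ e i + e j = 0
  · obtain ⟨i, hi, j, hj, hc, hs⟩ := hex
    have hij : i ≠ j := by
      rintro rfl
      rcases he i hi with h | h <;> rw [h] at hs <;> norm_num at hs
    have hj' : j ∈ U.erase i := Finset.mem_erase.2 ⟨hij.symm, hj⟩
    have hsub : ∀ {x}, x ∈ (U.erase i).erase j → x ∈ U := fun hx =>
      Finset.mem_of_mem_erase (Finset.mem_of_mem_erase hx)
    obtain ⟨M, g₁, g₂, hinj, h1, h2, hcc, hss, hcard⟩ := ih ((U.erase i).erase j)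
      ((Finset.erase_ssubset hj').trans (Finset.erase_ssubset hi)) fun x hx => he x (hsub hx)
    have n1 : ∀ k, g₁ k ≠ i ∧ g₁ k ≠ j := fun k =>
      ⟨Finset.ne_of_mem_erase (Finset.mem_of_mem_erase (h1 k)), Finset.ne_of_mem_erase (h1 k)⟩
    have n2 : ∀ k, g₂ k ≠ i ∧ g₂ k ≠ j := fun k =>
      ⟨Finset.ne_of_mem_erase (Finset.mem_of_mem_erase (h2 k)), Finset.ne_of_mem_erase (h2 k)⟩
    have i1 : Function.Injective g₁ := hinj.comp Sum.inl_injective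
    have i2 : Function.Injective g₂ := hinj.comp Sum.inr_injective
    have i12 : ∀ k l, g₁ k ≠ g₂ l := fun k l h => by simpa using @hinj (.inl k) (.inr l) h
    refine ⟨M + 1, Fin.cons i g₁, Fin.cons j g₂, Function.Injective.sumElim ?_ ?_ ?_,
      ?_, ?_, ?_, ?_, ?_⟩
    · refine Fin.cons_injective_iff.2 ⟨?_, i1⟩
      rintro ⟨k, hk⟩
      exact (n1 k).1 hk
    · refine Fin.cons_injective_iff.2 ⟨?_, i2⟩
      rintro ⟨k, hk⟩
      exact (n2 k).2 hk
    · intro k l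
      refine Fin.cases ?_ (fun k => ?_) k <;> refine Fin.cases ?_ (fun l => ?_) l
      · simpa using hij
      · simpa using (n2 l).1.symm
      · simpa using (n1 k).2
      · simpa using i12 k l
    · exact Fin.cases (by simpa using hi) fun k => by simpa using hsub (h1 k)
    · exact Fin.cases (by simpa using hj) fun k => by simpa using hsub (h2 k)
    · exact Fin.cases (by simpa using hc) fun k => by simpa using hcc k
    · exact Fin.cases (by simpa using hs) fun k => by simpa using hss k
    -- Removing a matched pair does not change the imbalance of any class.
    · have hsum : ∀ k, ∑ x ∈ U, (if c x = k then e x else 0) =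
          ∑ x ∈ (U.erase i).erase j, if c x = k then e x else 0 := by
        intro k
        rw [← Finset.add_sum_erase _ _ hi, ← Finset.add_sum_erase _ _ hj', ← add_assoc, hc]
        split_ifs
        · rw [hs, zero_add]
        · simp
      simp_rw [hsum]
      rw [← Finset.card_erase_add_one hi, ← Finset.card_erase_add_one hj']
      push_cast
      linarith
  · push Not at hex
    refine ⟨0, Fin.elim0, Fin.elim0, ?_, fun i => i.elim0, fun i => i.elim0, fun i => i.elim0,
      fun i => i.elim0, ?_⟩
    · rintro (i | i) <;> exact i.elim0
    · have hcard : (U.card : ℝ) = ∑ k, ∑ j ∈ U, if c j = k then (1 : ℝ) else 0 := by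
        rw [Finset.sum_comm]
        simp
      rw [hcard]
      simp only [Nat.cast_zero, mul_zero, zero_add]
      refine Finset.sum_le_sum fun k _ => ?_
      -- When no match is left, each class has one sign, so its imbalance equals its size.
      have hne : ∀ {i j}, i ∈ U → j ∈ U → c i = c j → e i = e j := by
        intro i j hi hj hc
        have := hex i hi j hj hc
        rcases he i hi with h | h <;> rcases he j hj with h' | h' <;> rw [h, h'] at this ⊢ <;>
          norm_num at this
      by_cases h : ∃ i ∈ U, c i = k
      · obtain ⟨i, hi, rfl⟩ := h
        have : ∑ j ∈ U, (if c j = c i then e j else 0) =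
            e i * ∑ j ∈ U, if c j = c i then (1 : ℝ) else 0 := by
          rw [Finset.mul_sum]
          refine Finset.sum_congr rfl fun j hj => ?_
          split_ifs with hji
          · rw [hne hj hi hji, mul_one]
          · simp
        rw [this, abs_mul]
        have h1 : |e i| = 1 := by rcases he i hi with h | h <;> rw [h] <;> simp
        rw [h1, one_mul]
        exact le_abs_self _
      · push Not at h
        rw [Finset.sum_congr rfl fun j hj => if_neg (h j hj)]
        simp

/-! ### Sign imbalance of uniform coefficients. -/

section CubeLaw

/-- The uniform distribution on `[-b, b]`. -/
noncomputable def unifLaw (b : ℝ) : Measure ℝ :=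
  ProbabilityTheory.cond (volume : Measure ℝ) (Set.Icc (-b) b)

lemma isProbabilityMeasure_unifLaw {b : ℝ} (hb : 0 < b) : IsProbabilityMeasure (unifLaw b) :=
  cond_isProbabilityMeasure_of_finite (by simp [hb]) (by simp)

lemma integral_unifLaw_of_odd {b : ℝ} (hb : 0 < b) {φ : ℝ → ℝ} (hφ : ∀ x, φ (-x) = -φ x) :
    ∫ x, φ x ∂unifLaw b = 0 := by
  have h : ∫ x in (-b)..b, φ x = 0 := by
    have h1 := intervalIntegral.integral_comp_neg (a := -b) (b := b) φ
    simp only [hφ, neg_neg, intervalIntegral.integral_neg] at h1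
    linarith
  rw [unifLaw, ProbabilityTheory.cond, integral_smul_measure, integral_Icc_eq_integral_Ioc,
    ← intervalIntegral.integral_of_le (by linarith), h, smul_zero]

lemma ae_unifLaw {b : ℝ} : ∀ᵐ x ∂unifLaw b, x ≠ 0 ∧ |x| ≤ b := by
  have h1 : ∀ᵐ x ∂unifLaw b, x ∈ Set.Icc (-b) b := ae_cond_mem measurableSet_Icc
  have h2 : ∀ᵐ x ∂unifLaw b, x ≠ 0 :=
    cond_absolutelyContinuous.ae_le (Measure.ae_ne volume (0 : ℝ))
  filter_upwards [h1, h2] with x hx hx0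
  exact ⟨hx0, abs_le.2 hx⟩

variable {p : ℕ} {b : ℝ}

lemma cubeLaw_eq : cubeLaw p b = Measure.pi fun _ : Fin p => unifLaw b := rfl

lemma ae_cubeLaw (hb : 0 < b) : ∀ᵐ β ∂cubeLaw p b, ∀ j, β j ≠ 0 ∧ |β j| ≤ b := by
  have := isProbabilityMeasure_unifLaw hb
  rw [ae_all_iff]
  intro j
  exact (measurePreserving_eval (fun _ : Fin p => unifLaw b) j).quasiMeasurePreserving.ae
    ae_unifLaw

lemma measurable_realSign : Measurable Real.sign :=
  Measurable.ite measurableSet_Iio measurable_const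
    (Measurable.ite measurableSet_Ioi measurable_const measurable_const)

/-- Total imbalance of signs in the classes given by `cls`. -/
noncomputable def imbalance {κ : Type*} [Fintype κ] [DecidableEq κ] (cls : Fin p → ℝ → κ)
    (β : Fin p → ℝ) : ℝ :=
  ∑ k, |∑ j, if cls j (β j) = k then Real.sign (β j) else 0|

variable {κ : Type*} [Fintype κ] [DecidableEq κ] [MeasurableSpace κ] [MeasurableSingletonClass κ]

lemma abs_realSign_le (x : ℝ) : |Real.sign x| ≤ 1 := by
  rcases Real.sign_apply_eq x with h | h | h <;> rw [h] <;> simp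

/-- Classes that depend on `x` evenly make each summand odd, hence centred, so second moments add
over the independent coordinates. Cauchy–Schwarz over the classes gives the rest. -/
lemma integral_imbalance_le (hb : 0 < b) {cls : Fin p → ℝ → κ} (hcls : ∀ j, Measurable (cls j))
    (heven : ∀ j x, cls j (-x) = cls j x) :
    Integrable (imbalance cls) (cubeLaw p b) ∧
    ∫ β, imbalance cls β ∂cubeLaw p b ≤ √(Fintype.card κ * p) := by
  have := isProbabilityMeasure_unifLaw hb
  have hprob : IsProbabilityMeasure (cubeLaw p b) := by rw [cubeLaw_eq]; infer_instance
  set φ : κ → Fin p → ℝ → ℝ := fun k j x => if cls j x = k then Real.sign x else 0 with hφ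
  have hφm : ∀ k j, Measurable (φ k j) := fun k j =>
    Measurable.ite (hcls j (measurableSet_singleton k)) measurable_realSign measurable_const
  have hφ1 : ∀ k j x, |φ k j x| ≤ 1 := fun k j x => by
    simp only [hφ]; split_ifs
    · exact abs_realSign_le x
    · simp
  have hφLp : ∀ k j, MemLp (φ k j) 2 (unifLaw b) := fun k j =>
    MemLp.of_bound (hφm k j).aestronglyMeasurable 1 (ae_of_all _ fun x => hφ1 k j x)
  have hφ0 : ∀ k j, ∫ x, φ k j x ∂unifLaw b = 0 := fun k j => by
    refine integral_unifLaw_of_odd hb fun x => ?_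
    simp only [hφ, heven, Real.sign_neg]
    split_ifs <;> simp
  set S : κ → (Fin p → ℝ) → ℝ := fun k β => ∑ j, φ k j (β j) with hS
  have hSm : ∀ k, Measurable (S k) := fun k =>
    Finset.measurable_sum _ fun j _ => (hφm k j).comp (measurable_pi_apply j)
  have hSbd : ∀ k β, |S k β| ≤ p := fun k β => by
    refine (Finset.abs_sum_le_sum_abs _ _).trans ((Finset.sum_le_sum fun j _ =>
      hφ1 k j (β j)).trans ?_)
    simp
  have hSi : ∀ k, Integrable (S k) (cubeLaw p b) := fun k =>
    Integrable.of_bound (hSm k).aestronglyMeasurable p (ae_of_all _ fun β => hSbd k β)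
  have hSsq : ∀ k, Integrable (fun β => S k β ^ 2) (cubeLaw p b) := fun k =>
    (MemLp.of_bound (hSm k).aestronglyMeasurable p (ae_of_all _ fun β => hSbd k β)).integrable_sq
  have hS0 : ∀ k, ∫ β, S k β ∂cubeLaw p b = 0 := fun k => by
    rw [hS, integral_finsetSum]
    · refine Finset.sum_eq_zero fun j _ => ?_
      rw [cubeLaw_eq, integral_comp_eval (μ := fun _ : Fin p => unifLaw b)
        (hφm k j).aestronglyMeasurable]
      exact hφ0 k j
    · intro j _
      exact Integrable.of_bound ((hφm k j).comp (measurable_pi_apply j)).aestronglyMeasurable 1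
        (ae_of_all _ fun β => hφ1 k j _)
  have hvar : ∀ k, ∫ β, S k β ^ 2 ∂cubeLaw p b = ∑ j, ∫ x, φ k j x ^ 2 ∂unifLaw b := fun k => by
    have h := variance_sum_pi (μ := fun _ : Fin p => unifLaw b) (X := fun j => φ k j) (hφLp k)
    have e : (∑ j, fun β : Fin p → ℝ => φ k j (β j)) = S k := by ext β; simp [hS]
    rw [e, ← cubeLaw_eq, variance_of_integral_eq_zero (hSm k).aemeasurable (hS0 k)] at h
    rw [h]
    exact Finset.sum_congr rfl fun j _ =>
      variance_of_integral_eq_zero (hφm k j).aemeasurable (hφ0 k j)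
  have htot : ∑ k, ∫ β, S k β ^ 2 ∂cubeLaw p b ≤ p := by
    simp_rw [hvar]
    rw [Finset.sum_comm]
    calc _ ≤ ∑ _j : Fin p, (1 : ℝ) := by
          refine Finset.sum_le_sum fun j _ => ?_
          rw [← integral_finsetSum _ fun k _ => (hφLp k j).integrable_sq]
          -- Each coordinate belongs to a single class, so the variances over all classes total at
          -- most `p`.
          have hpt : ∀ x, ∑ k, φ k j x ^ 2 ≤ 1 := by
            intro x
            have : ∀ k, φ k j x ^ 2 = if cls j x = k then Real.sign x ^ 2 else 0 := fun k => by
              simp only [hφ]; split_ifs <;> simp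
            simp_rw [this]
            rw [Finset.sum_ite_eq]
            simpa using abs_realSign_le x
          calc _ ≤ ∫ _, (1 : ℝ) ∂unifLaw b :=
                integral_mono (integrable_finsetSum _ fun k _ => (hφLp k j).integrable_sq)
                  (integrable_const _) hpt
            _ = 1 := by simp
      _ = p := by simp
  have habs : ∀ k, Integrable (fun β => |S k β|) (cubeLaw p b) := fun k => (hSi k).abs
  refine ⟨integrable_finsetSum _ fun k _ => habs k, ?_⟩
  calc ∫ β, imbalance cls β ∂cubeLaw p b = ∑ k, ∫ β, |S k β| ∂cubeLaw p b :=
        integral_finsetSum _ fun k _ => habs k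
    _ ≤ ∑ k, √(∫ β, S k β ^ 2 ∂cubeLaw p b) := by
        refine Finset.sum_le_sum fun k _ => ?_
        have := integral_sqrt_le ((hSm k).pow_const 2) (fun β => sq_nonneg _) (hSsq k)
        simpa only [Real.sqrt_sq_eq_abs] using this
    _ ≤ √(Fintype.card κ * p) := by
        refine Real.le_sqrt_of_sq_le (sq_sum_le_card_mul_sum_sq.trans ?_)
        simp only [Real.sq_sqrt (integral_nonneg fun β => sq_nonneg _)]
        exact mul_le_mul_of_nonneg_left htot (by positivity)

end CubeLaw

/-! ### Power bound through binning, and its limit. -/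

section BlockBounds

variable {p ℓ : ℕ}

/-- Class of a coefficient: the block of its feature and the bin of its magnitude. -/
noncomputable def coefClass (block : Fin p → Fin ℓ) (b : ℝ) (m : ℕ) (j : Fin p) (x : ℝ) :
    Fin ℓ × Fin (m + 1) :=
  (block j, ⟨min ⌊|x| * m / b⌋₊ m, by omega⟩)

lemma measurable_coefClass (block : Fin p → Fin ℓ) (b : ℝ) (m : ℕ) (j : Fin p) :
    Measurable (coefClass block b m j) := by
  have h : Measurable fun x : ℝ => ⌊|x| * m / b⌋₊ := Nat.measurable_floor.comp (by fun_prop)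
  exact (measurable_from_top (f := fun k : ℕ => ((block j, ⟨min k m, by omega⟩) :
    Fin ℓ × Fin (m + 1)))).comp h

lemma coefClass_neg (block : Fin p → Fin ℓ) (b : ℝ) (m : ℕ) (j : Fin p) (x : ℝ) :
    coefClass block b m j (-x) = coefClass block b m j x := by
  simp [coefClass]

lemma abs_abs_sub_abs_lt_of_coefClass_eq {block : Fin p → Fin ℓ} {b : ℝ} (hb : 0 < b) {m : ℕ}
    (hm : 0 < m) {i j : Fin p} {x y : ℝ} (hx : |x| ≤ b) (hy : |y| ≤ b)
    (h : coefClass block b m i x = coefClass block b m j y) : |(|x| - |y|)| < b / m := by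
  have hm' : (0 : ℝ) < m := by exact_mod_cast hm
  have hle : ∀ {z : ℝ}, |z| ≤ b → ⌊|z| * m / b⌋₊ ≤ m := fun {z} hz => by
    refine Nat.floor_le_of_le ?_
    rw [div_le_iff₀ hb, mul_comm]
    gcongr
  have h2 := congrArg (fun c => (c.2 : ℕ)) h
  simp only [coefClass, min_eq_left (hle hx), min_eq_left (hle hy)] at h2
  have hx1 := Nat.floor_le (a := |x| * m / b) (by positivity)
  have hx2 := Nat.lt_floor_add_one (|x| * m / b)
  have hy1 := Nat.floor_le (a := |y| * m / b) (by positivity)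
  have hy2 := Nat.lt_floor_add_one (|y| * m / b)
  rw [h2] at hx1 hx2
  have e : |x| * m / b - |y| * m / b = (|x| - |y|) * (m / b) := by ring
  have hmb : (0 : ℝ) < m / b := by positivity
  have hinv : b / m * (m / b) = 1 := by field_simp
  rw [abs_lt]
  constructor
  · refine lt_of_mul_lt_mul_right ?_ hmb.le
    rw [neg_mul, hinv, ← e]; linarith
  · refine lt_of_mul_lt_mul_right ?_ hmb.le
    rw [hinv, ← e]; linarith

lemma power_eq {n : ℕ} (q : ℝ) (μ : Measure (Data n p)) (w : Kernel (Data n p) (Fin p → ℝ))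
    {β : Fin p → ℝ} (hβ : ∀ j, β j ≠ 0) :
    power q μ w β = expectedDiscoveries q μ w / p := by
  simp [power, expectedDiscoveries, hβ]

/-- The right-hand side does not involve `w`, so it also bounds the supremum over statistics. -/
lemma exists_power_le : ∃ C : ℝ, 0 ≤ C ∧ ∀ {n p ℓ : ℕ} {block : Fin p → Fin ℓ}
    {ρ : Fin ℓ → ℝ} {s : Fin p → ℝ} {f : ℝ → ℝ → ℝ} {v : ℝ≥0} {b : ℝ} (q : ℝ) {β : Fin p → ℝ}
    {w : Kernel (Data n p) (Fin p → ℝ)} {m : ℕ},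
    q ≤ 1 / 10 → (∀ k, 1 / 2 ≤ ρ k ∧ ρ k ≤ 1) → IsSDPSolution (blockEquicorr block ρ) s →
    Measurable (Function.uncurry f) → v ≠ 0 → IsPermInvariantStat w → 0 < b → 0 < m → 0 < p →
    (∀ j, β j ≠ 0 ∧ |β j| ≤ b) →
    power q (dataLaw n (blockEquicorr block ρ) s v f β) w β ≤
      12 * b / √v * (√n / m) + C / p + 3 * imbalance (coefClass block b m) β / p := by
  obtain ⟨C, hC0, hC⟩ := exists_expectedDiscoveries_le
  refine ⟨C, hC0, fun {n p ℓ block ρ s f v b} q {β w m} hq hρ hs hf hv hw hb hm hp hβ => ?_⟩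
  have hp' : (0 : ℝ) < p := by exact_mod_cast hp
  have hsign : ∀ j, Real.sign (β j) = 1 ∨ Real.sign (β j) = -1 := fun j =>
    (Real.sign_apply_eq_of_ne_zero _ (hβ j).1).symm
  obtain ⟨M, g₁, g₂, hg, -, -, hcls, hopp, hcard⟩ := exists_opposite_pairs
    (fun j => coefClass block b m j (β j)) (fun j => Real.sign (β j)) Finset.univ
    fun j _ => hsign j
  have h2M : 2 * M ≤ p := by
    have := Fintype.card_le_of_injective _ hg
    simpa [two_mul] using this
  have h2M' : 2 * (M : ℝ) ≤ p := by exact_mod_cast h2M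
  have hM' : ((p - 2 * M : ℕ) : ℝ) ≤ imbalance (coefClass block b m) β := by
    rw [Nat.cast_sub h2M]
    simp only [Finset.card_univ, Fintype.card_fin] at hcard
    push_cast
    unfold imbalance
    linarith
  have hpair : ∀ i, |β (g₁ i) + β (g₂ i)| ≤ b / m := by
    intro i
    have h := abs_abs_sub_abs_lt_of_coefClass_eq hb hm (hβ _).2 (hβ _).2 (hcls i)
    have hopp' := hopp i
    have e : ∀ j, β j = Real.sign (β j) * |β j| := fun j => by
      rcases lt_or_gt_of_ne (hβ j).1 with h | h
      · rw [Real.sign_of_neg h, abs_of_neg h]; ring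
      · rw [Real.sign_of_pos h, abs_of_pos h, one_mul]
    rcases hsign (g₁ i) with h1 | h1
    · have h2 : Real.sign (β (g₂ i)) = -1 := by simp only [h1] at hopp'; linarith
      rw [e (g₁ i), e (g₂ i), h1, h2]
      rw [show 1 * |β (g₁ i)| + -1 * |β (g₂ i)| = |β (g₁ i)| - |β (g₂ i)| by ring]
      exact h.le
    · have h2 : Real.sign (β (g₂ i)) = 1 := by simp only [h1] at hopp'; linarith
      rw [e (g₁ i), e (g₂ i), h1, h2]
      rw [show -1 * |β (g₁ i)| + 1 * |β (g₂ i)| = -(|β (g₁ i)| - |β (g₂ i)|) by ring, abs_neg]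
      exact h.le
  have hblock : ∀ i, block (g₁ i) = block (g₂ i) := fun i => congrArg Prod.fst (hcls i)
  have hE := hC (n := n) q β hq hρ hs hf hv hw hg hblock (M' := p - 2 * M) (by omega)
  rw [power_eq q _ w fun j => (hβ j).1, div_le_iff₀ hp']
  refine hE.trans ?_
  have hsum : 24 * ∑ i, √n * |β (g₁ i) + β (g₂ i)| / √v ≤ 12 * b / √v * (√n / m) * p := by
    calc _ ≤ 24 * ∑ _i : Fin M, √n * (b / m) / √v := by
          gcongr with i
          exact hpair i
      _ = 12 * b / √v * (√n / m) * (2 * M) := by simp; ring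
      _ ≤ _ := by gcongr
  have e : (12 * b / √v * (√n / m) + C / p + 3 * imbalance (coefClass block b m) β / p) * p =
      12 * b / √v * (√n / m) * p + C + 3 * imbalance (coefClass block b m) β := by
    field_simp
  rw [e]
  linarith

lemma cubeLaw_imbalance_ge_le {block : Fin p → Fin ℓ} {b : ℝ} (hb : 0 < b) (m : ℕ) (hp : 0 < p)
    {δ : ℝ} (hδ : 0 < δ) :
    cubeLaw p b {β | δ ≤ 3 * imbalance (coefClass block b m) β / p} ≤
      ENNReal.ofReal (3 / δ * √((m + 1) * (ℓ / p))) := by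
  have := isProbabilityMeasure_unifLaw hb
  have hprob : IsProbabilityMeasure (cubeLaw p b) := by rw [cubeLaw_eq]; infer_instance
  have hp' : (0 : ℝ) < p := by exact_mod_cast hp
  obtain ⟨hi, hle⟩ := integral_imbalance_le (p := p) hb (measurable_coefClass block b m)
    (coefClass_neg block b m)
  have hM := mul_meas_ge_le_integral_of_nonneg (μ := cubeLaw p b)
    (f := fun β => 3 * imbalance (coefClass block b m) β / p)
    (ae_of_all _ fun β => by simp only [imbalance, Pi.zero_apply]; positivity)
    ((hi.const_mul 3).div_const _) δ
  rw [integral_div, integral_const_mul] at hM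
  rw [← ofReal_measureReal]
  refine ENNReal.ofReal_le_ofReal ?_
  rw [div_mul_eq_mul_div, le_div_iff₀ hδ, mul_comm]
  refine hM.trans ?_
  rw [mul_div_assoc]
  refine mul_le_mul_of_nonneg_left ?_ (by norm_num)
  rw [div_le_iff₀ hp']
  refine hle.trans (le_of_eq ?_)
  have e : (p : ℝ) = √(p ^ 2) := (Real.sqrt_sq hp'.le).symm
  conv_rhs => rw [e]
  rw [← Real.sqrt_mul (by positivity)]
  congr 1
  simp
  field_simp

/-- Convergence to zero of the best power along a sequence of block-equicorrelated designs. -/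
lemma tendsto_cubeLaw_iSup_power {q b ε : ℝ} {v : ℝ≥0} (hq : q ≤ 1 / 10) (hb : 0 < b) (hε : 0 < ε)
    (hv : 0 < v) {n p ℓ : ℕ → ℕ} {block : ∀ k, Fin (p k) → Fin (ℓ k)} {ρ : ∀ k, Fin (ℓ k) → ℝ}
    {f : ℕ → ℝ → ℝ → ℝ} {s : ∀ k, Fin (p k) → ℝ} (hp : Tendsto p atTop atTop)
    (hρ : ∀ k i, 1 / 2 ≤ ρ k i ∧ ρ k i ≤ 1) (hf : ∀ k, Measurable (Function.uncurry (f k)))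
    (hs : ∀ k, IsSDPSolution (blockEquicorr (block k) (ρ k)) (s k))
    (hn : (fun k => (n k : ℝ)) =o[atTop] fun k => ((p k : ℝ) / (ℓ k : ℝ)) ^ (2 - 2 * ε))
    (hℓ : Tendsto (fun k => (ℓ k : ℝ) / p k) atTop (𝓝 0)) {δ : ℝ} (hδ : 0 < δ) :
    Tendsto (fun k => cubeLaw (p k) b
      {β | δ ≤ ⨆ w : PermInvariantStat (n k) (p k),
        power q (dataLaw (n k) (blockEquicorr (block k) (ρ k)) (s k) v (f k) β) w.1 β})
      atTop (𝓝 0) := by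
  obtain ⟨C, hC0, hC⟩ := exists_power_le
  set K : ℕ → ℝ := fun k => (p k : ℝ) / ℓ k with hK
  -- The exponent balances two demands: `m` must dominate `√n = o(K^(1-ε))`, yet stay `o(K)` so that
  -- most coefficients find a partner. The `+ 1` keeps `m` positive.
  set m : ℕ → ℕ := fun k => ⌈K k ^ (1 - ε)⌉₊ + 1 with hm
  have hppos : ∀ᶠ k in atTop, 0 < p k := hp.eventually_gt_atTop 0
  have hℓpos : ∀ᶠ k in atTop, 0 < ℓ k := by
    filter_upwards [hppos] with k hk
    exact (Nat.zero_le _).trans_lt (block k ⟨0, hk⟩).2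
  have hKpos : ∀ᶠ k in atTop, 0 < K k := by
    filter_upwards [hppos, hℓpos] with k h1 h2
    have h1' : (0 : ℝ) < p k := by exact_mod_cast h1
    have h2' : (0 : ℝ) < ℓ k := by exact_mod_cast h2
    exact div_pos h1' h2'
  have hKtop : Tendsto K atTop atTop := by
    have h : Tendsto (fun k => (ℓ k : ℝ) / p k) atTop (𝓝[>] 0) := by
      refine tendsto_nhdsWithin_iff.2 ⟨hℓ, ?_⟩
      filter_upwards [hppos, hℓpos] with k h1 h2
      have h1' : (0 : ℝ) < p k := by exact_mod_cast h1
      have h2' : (0 : ℝ) < ℓ k := by exact_mod_cast h2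
      exact div_pos h2' h1'
    refine (tendsto_inv_nhdsGT_zero.comp h).congr fun k => ?_
    simp [hK]
  have hsqrt : Tendsto (fun k => √(n k : ℝ) / m k) atTop (𝓝 0) := by
    have h1 : Tendsto (fun k => √((n k : ℝ) / K k ^ (2 - 2 * ε))) atTop (𝓝 0) := by
      have := (Real.continuous_sqrt.tendsto 0).comp hn.tendsto_div_nhds_zero
      rwa [Real.sqrt_zero] at this
    refine tendsto_of_tendsto_of_tendsto_of_le_of_le' tendsto_const_nhds h1
      (Eventually.of_forall fun k => by positivity) ?_
    filter_upwards [hKpos] with k hk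
    have h2 : √(K k ^ (2 - 2 * ε)) = K k ^ (1 - ε) := by
      rw [show 2 - 2 * ε = (1 - ε) * 2 by ring, Real.rpow_mul hk.le, Real.rpow_two,
        Real.sqrt_sq (by positivity)]
    rw [Real.sqrt_div' _ (by positivity), h2]
    have h3 : K k ^ (1 - ε) ≤ m k := by
      rw [hm]; push_cast
      linarith [Nat.le_ceil (K k ^ (1 - ε))]
    gcongr
  have hmain : Tendsto (fun k => 12 * b / √v * (√(n k : ℝ) / m k) + C / p k) atTop (𝓝 0) := by
    have h1 := hsqrt.const_mul (12 * b / √v)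
    have h2 : Tendsto (fun k => C / (p k : ℝ)) atTop (𝓝 0) :=
      (tendsto_natCast_atTop_atTop.comp hp).const_div_atTop C
    simpa using h1.add h2
  have hbins : Tendsto (fun k => ((m k : ℝ) + 1) * ((ℓ k : ℝ) / p k)) atTop (𝓝 0) := by
    have h1 : Tendsto (fun k => K k ^ (-ε) + 3 * (K k)⁻¹) atTop (𝓝 0) := by
      have := ((tendsto_rpow_neg_atTop hε).comp hKtop).add
        ((tendsto_inv_atTop_zero.comp hKtop).const_mul 3)
      simpa using this
    refine tendsto_of_tendsto_of_tendsto_of_le_of_le' tendsto_const_nhds h1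
      (Eventually.of_forall fun k => by positivity) ?_
    filter_upwards [hKpos] with k hk
    have e1 : (ℓ k : ℝ) / p k = (K k)⁻¹ := by simp [hK]
    have e2 : K k ^ (-ε) = K k ^ (1 - ε) * (K k)⁻¹ := by
      rw [← Real.rpow_neg_one, ← Real.rpow_add hk]; congr 1; ring
    rw [e1, e2, ← add_mul]
    have h3 : (m k : ℝ) ≤ K k ^ (1 - ε) + 2 := by
      rw [hm]; push_cast
      linarith [Nat.ceil_lt_add_one (a := K k ^ (1 - ε)) (by positivity)]
    exact mul_le_mul_of_nonneg_right (by linarith) (inv_nonneg.2 hk.le)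
  have hbound : Tendsto (fun k => ENNReal.ofReal
      (3 / (δ / 2) * √(((m k : ℝ) + 1) * ((ℓ k : ℝ) / p k)))) atTop (𝓝 0) := by
    have h1 := ((Real.continuous_sqrt.tendsto 0).comp hbins).const_mul (3 / (δ / 2))
    rw [Real.sqrt_zero, mul_zero] at h1
    have := (ENNReal.continuous_ofReal.tendsto 0).comp h1
    rwa [ENNReal.ofReal_zero] at this
  refine tendsto_of_tendsto_of_tendsto_of_le_of_le' tendsto_const_nhds hbound
    (Eventually.of_forall fun k => zero_le) ?_
  filter_upwards [hppos, hmain.eventually_lt_const (half_pos hδ)] with k hpk hk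
  -- Comparing events almost everywhere requires no measurability of the supremum over `w`.
  refine le_trans (measure_mono_ae ?_) (cubeLaw_imbalance_ge_le (block := block k) hb (m k) hpk
    (half_pos hδ))
  filter_upwards [ae_cubeLaw (p := p k) hb] with β hβ hδβ
  change δ / 2 ≤ 3 * imbalance (coefClass (block k) b (m k)) β / p k
  change δ ≤ _ at hδβ
  have himb : 0 ≤ imbalance (coefClass (block k) b (m k)) β := by unfold imbalance; positivity
  -- `Real.iSup_le` also asks that the bound be nonnegative, because an empty real supremum is `0`.
  have hsup := Real.iSup_le (fun w : PermInvariantStat (n k) (p k) =>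
    hC q hq (hρ k) (hs k) (hf k) hv.ne' w.2 hb (Nat.succ_pos _ : 0 < m k) hpk hβ)
    (by positivity)
  linarith

end BlockBounds

/-! ### Assembly of the three claims. -/

lemma equicorr_eq_blockEquicorr (p : ℕ) (ρ : ℝ) :
    equicorr p ρ = blockEquicorr (fun _ : Fin p => (0 : Fin 1)) fun _ => ρ := by
  ext i j
  simp [equicorr, blockEquicorr]

/-- The bound on the expected number of discoveries for block-equicorrelated designs. -/
lemma exists_expectedDiscoveries_div_le : ∃ C₁ C₂ C₃ : ℝ, ∀ v : ℝ≥0, 0 < v → ∃ c₀ : ℝ, 0 < c₀ ∧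
    ∀ (n p ℓ : ℕ) (q : ℝ) (block : Fin p → Fin ℓ) (ρ : Fin ℓ → ℝ) (f : ℝ → ℝ → ℝ)
      (s β : Fin p → ℝ) (w : Kernel (Data n p) (Fin p → ℝ)), q ≤ 1 / 10 →
      (∀ i, 1 / 2 ≤ ρ i ∧ ρ i ≤ 1) → Measurable (Function.uncurry f) →
      IsSDPSolution (blockEquicorr block ρ) s → IsPermInvariantStat w →
      ∀ (b m : ℝ), 0 < b → 0 < m →
      ∀ (M : ℕ) (g₁ g₂ : Fin M → Fin p), Function.Injective (Sum.elim g₁ g₂) →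
        (∀ i, block (g₁ i) = block (g₂ i)) → (∀ i, |β (g₁ i) + β (g₂ i)| < b / m) →
      ∀ (M' : ℕ), M' + 2 * M = p → ∀ (α₁ α₂ : ℝ), α₁ < 0.001 → 0 < α₂ →
        c₀ * √(n : ℝ) * b / m < α₁ * α₂ →
        expectedDiscoveries q (dataLaw n (blockEquicorr block ρ) s v f β) w / (p : ℝ) ≤
          (C₁ * (M' : ℝ) + C₂) / (p : ℝ) + C₃ * α₂ := by
  obtain ⟨C, hC0, hC⟩ := exists_expectedDiscoveries_le
  refine ⟨3, C, 12, fun v hv => ?_⟩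
  have hv' : (0 : ℝ) < √v := Real.sqrt_pos.2 (by exact_mod_cast hv)
  refine ⟨1 / √v, by positivity, ?_⟩
  intro n p ℓ q block ρ f s β w hq hρ hf hs hw b m hb hm M g₁ g₂ hg hblock hpair M' hM α₁ α₂
    hα₁ hα₂ hα
  have hE := hC (n := n) q β hq hρ hs hf hv.ne' hw hg hblock hM
  -- For `p = 0` the quotients are `0` by convention and only `C₃ * α₂ ≥ 0` remains.
  rcases Nat.eq_zero_or_pos p with rfl | hp
  · simp; positivity
  have hp' : (0 : ℝ) < p := by exact_mod_cast hp
  rw [div_add' _ _ _ hp'.ne', div_le_div_iff_of_pos_right hp']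
  have h2M : 2 * (M : ℝ) ≤ p := by
    have : 2 * M ≤ p := by omega
    exact_mod_cast this
  have hsmall : √n * (b / m) / √v ≤ α₂ := by
    have e : √n * (b / m) / √v = 1 / √v * √n * b / m := by ring
    rw [e]
    refine hα.le.trans ?_
    -- As `α₁ < 1`, the product `α₁ * α₂` is at most `α₂`.
    nlinarith
  have hsum : 24 * ∑ i, √n * |β (g₁ i) + β (g₂ i)| / √v ≤ 12 * α₂ * p := by
    calc _ ≤ 24 * ∑ _i : Fin M, α₂ := by
          refine mul_le_mul_of_nonneg_left (Finset.sum_le_sum fun i _ => ?_) (by norm_num)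
          refine le_trans ?_ hsmall
          gcongr
          exact (hpair i).le
      _ = 12 * α₂ * (2 * M) := by simp; ring
      _ ≤ _ := by gcongr
  linarith

end Knockoff

theorem theorem2p3 :
    -- equicorrelated designs: the best average power tends to zero in probability
    (∀ (q b ε : ℝ) (v : ℝ≥0), 0 ≤ q → q ≤ 1 / 10 → 0 < b → 0 < ε → 0 < v →
      ∀ (n p : ℕ → ℕ) (ρ : ℕ → ℝ) (f : ℕ → ℝ → ℝ → ℝ) (s : ∀ k, Fin (p k) → ℝ),
        Tendsto n atTop atTop → Tendsto p atTop atTop →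
        (∀ k, 1 / 2 ≤ ρ k ∧ ρ k ≤ 1) →
        (∀ k, Measurable (Function.uncurry (f k))) →
        (∀ k, Knockoff.IsSDPSolution (Knockoff.equicorr (p k) (ρ k)) (s k)) →
        ((fun k => (n k : ℝ)) =o[atTop] fun k => (p k : ℝ) ^ (2 - ε)) →
        ∀ δ : ℝ, 0 < δ →
          Tendsto (fun k => Knockoff.cubeLaw (p k) b
            {β | δ ≤ ⨆ w : Knockoff.PermInvariantStat (n k) (p k),
              Knockoff.power q
                (Knockoff.dataLaw (n k) (Knockoff.equicorr (p k) (ρ k)) (s k) v (f k) β) w.1 β})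
            atTop (𝓝 0)) ∧
    -- block-equicorrelated designs: the bound on the expected number of discoveries
    (∃ C₁ C₂ C₃ : ℝ, ∀ v : ℝ≥0, 0 < v → ∃ c₀ : ℝ, 0 < c₀ ∧
      ∀ (n p ℓ : ℕ) (q : ℝ) (block : Fin p → Fin ℓ) (ρ : Fin ℓ → ℝ) (f : ℝ → ℝ → ℝ)
        (s β : Fin p → ℝ) (w : Kernel (Knockoff.Data n p) (Fin p → ℝ)),
        0 ≤ q → q ≤ 1 / 10 →
        (∀ i, 1 / 2 ≤ ρ i ∧ ρ i ≤ 1) →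
        Measurable (Function.uncurry f) →
        Knockoff.IsSDPSolution (Knockoff.blockEquicorr block ρ) s →
        Knockoff.IsPermInvariantStat w →
        ∀ (b m : ℝ), 0 < b → 0 < m →
        ∀ (M : ℕ) (g₁ g₂ : Fin M → Fin p), Function.Injective (Sum.elim g₁ g₂) →
          (∀ i, block (g₁ i) = block (g₂ i)) → (∀ i, |β (g₁ i) + β (g₂ i)| < b / m) →
        ∀ (M' : ℕ), M' + 2 * M = p → (M' : ℝ) ≤ (p : ℝ) / 50 →
        ∀ (α₁ α₂ : ℝ), 0 < α₁ → α₁ < 0.001 → 0 < α₂ → c₀ * √(n : ℝ) * b / m < α₁ * α₂ →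
          Knockoff.expectedDiscoveries q
              (Knockoff.dataLaw n (Knockoff.blockEquicorr block ρ) s v f β) w / (p : ℝ) ≤
            (C₁ * (M' : ℝ) + C₂) / (p : ℝ) + C₃ * α₂) ∧
    -- block-equicorrelated designs with equal blocks: convergence of the best average power
    (∀ (q b ε : ℝ) (v : ℝ≥0), 0 ≤ q → q ≤ 1 / 10 → 0 < b → 0 < ε → 0 < v →
      ∀ (n p ℓ : ℕ → ℕ) (block : ∀ k, Fin (p k) → Fin (ℓ k)) (ρ : ∀ k, Fin (ℓ k) → ℝ)
        (f : ℕ → ℝ → ℝ → ℝ) (s : ∀ k, Fin (p k) → ℝ),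
        Tendsto n atTop atTop → Tendsto p atTop atTop →
        (∀ k i, (Finset.univ.filter fun j => block k j = i).card * ℓ k = p k) →
        (∀ k i, 1 / 2 ≤ ρ k i ∧ ρ k i ≤ 1) →
        (∀ k, Measurable (Function.uncurry (f k))) →
        (∀ k, Knockoff.IsSDPSolution (Knockoff.blockEquicorr (block k) (ρ k)) (s k)) →
        ((fun k => (n k : ℝ)) =o[atTop] fun k => ((p k : ℝ) / (ℓ k : ℝ)) ^ (2 - 2 * ε)) →
        ((fun k => (ℓ k : ℝ)) =o[atTop]
          fun k => (p k : ℝ) / (Real.log (p k : ℝ)) ^ (1 / ε)) →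
        ∀ δ : ℝ, 0 < δ →
          Tendsto (fun k => Knockoff.cubeLaw (p k) b
            {β | δ ≤ ⨆ w : Knockoff.PermInvariantStat (n k) (p k),
              Knockoff.power q
                (Knockoff.dataLaw (n k) (Knockoff.blockEquicorr (block k) (ρ k)) (s k) v (f k) β)
                w.1 β})
            atTop (𝓝 0)) := by
  refine ⟨?_, ?_, ?_⟩
  · intro q b ε v _ hq hb hε hv n p ρ f s _ hp hρ hf hs hn δ hδ
    simp only [Knockoff.equicorr_eq_blockEquicorr] at hs ⊢
    -- One block, and `2 - 2(ε/2) = 2 - ε`.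
    refine Knockoff.tendsto_cubeLaw_iSup_power (ε := ε / 2) hq hb (by positivity) hv hp
      (fun k _ => hρ k) hf hs ?_ ?_ hδ
    · simpa [mul_div_cancel₀] using hn
    · simpa [Function.comp_def] using
        tendsto_inv_atTop_zero.comp (tendsto_natCast_atTop_atTop (R := ℝ) |>.comp hp)
  · obtain ⟨C₁, C₂, C₃, h⟩ := Knockoff.exists_expectedDiscoveries_div_le
    refine ⟨C₁, C₂, C₃, fun v hv => ?_⟩
    obtain ⟨c₀, hc₀, h⟩ := h v hv
    refine ⟨c₀, hc₀, ?_⟩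
    intro n p ℓ q block ρ f s β w _ hq hρ hf hs hw b m hb hm M g₁ g₂ hg hblock hpair M' hM _ α₁ α₂
      _ hα₁ hα₂ hα
    exact h n p ℓ q block ρ f s β w hq hρ hf hs hw b m hb hm M g₁ g₂ hg hblock hpair M' hM α₁ α₂
      hα₁ hα₂ hα
  · intro q b ε v _ hq hb hε hv n p ℓ block ρ f s _ hp _ hρ hf hs hn hℓ δ hδ
    refine Knockoff.tendsto_cubeLaw_iSup_power hq hb hε hv hp hρ hf hs hn ?_ hδ
    -- Only `ℓ/p → 0` is needed here; the logarithmic factor is eventually at least `1`.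
    refine tendsto_of_tendsto_of_tendsto_of_le_of_le' tendsto_const_nhds hℓ.tendsto_div_nhds_zero
      (Eventually.of_forall fun k => by positivity) ?_
    have hlog := (Real.tendsto_log_atTop.comp (tendsto_natCast_atTop_atTop (R := ℝ))).comp hp
    filter_upwards [hlog.eventually_ge_atTop 1, hp.eventually_gt_atTop 0] with k hk hpk
    have hpk' : (0 : ℝ) < p k := by exact_mod_cast hpk
    have h1 : 1 ≤ Real.log (p k : ℝ) ^ (1 / ε) := Real.one_le_rpow hk (by positivity)
    have h2 : 0 < (p k : ℝ) / Real.log (p k : ℝ) ^ (1 / ε) := by positivity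
    exact div_le_div_of_nonneg_left (Nat.cast_nonneg _) h2 (div_le_self hpk'.le h1)
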